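/- Let $\mathbf{k}$ be a field and $\Omega$ a set of operator indices. For a set $Z$, let $\mathcal S(Z)$ be the free semigroup on $Z$ and $\mathfrak S(Z)$ the free $\Omega$-semigroup on $Z$, i.e. the free semigroup with maps $w\mapsto\lfloor w\rfloor_\omega$ ($\omega\in\Omega$); its elements are the nonempty words whose letters are elements of $Z$ or bracketed words $\lfloor w\rfloor_\omega$, and the number of letters at the outermost level is the breadth $|w|$. Then $\mathbf k\mathfrak S(Z)$ is the free nonunital $\Omega$-algebra on $Z$. Let $\mathfrak S^\star(Z)$ be the set of elements of $\mathfrak S(Z\cup\{\star\})$ containing $\star$ exactly once; for $q\in\mathfrak S^\star(Z)$ write $q|_u$ for the result of replacing $\star$ by $u$, extended linearly to $u\in\mathbf k\mathfrak S(Z)$; $u$ is a subword of $q|_u$. A monomial order on $\mathfrak S(Z)$ is a well order such that $u<v$ implies $q|_u<q|_v$ for all $q\in\mathfrak S^\star(Z)$. The leading monomial $\bar f$ of $f\neq0$ is the largest monomial appearing in $f$. A set $\mathcal G\subseteq\mathbf k\mathfrak S(Z)$ is an $\Omega$-GS basis with respect to $\le$ if, for all nonzero $f,g\in\mathcal G$,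 made monic by dividing by their leading coefficients, every intersection composition $fu-vg$ (where $u,v,p\in\mathfrak S(Z)$, $p=\bar fu=v\bar g$, $\max\{|\bar f|,|\bar g|\}<|p|<|\bar f|+|\bar g|$) and every inclusion composition $f-q|_g$ (where $q\in\mathfrak S^\star(Z)$, $p=\bar f=q|_{\bar g}$) is trivial modulo $(\mathcal G,p)$, i.e. is a finite sum $\sum_i c_iq_i|_{s_i}$ with $c_i\in\mathbf k$, $q_i\in\mathfrak S^\star(Z)$, $s_i\in\mathcal G$ and $q_i|_{\bar s_i}<p$. It is an $\Omega$-GS basis of an $\Omega$-ideal $I$ (a two-sided ideal closed under all operators) if moreover it generates $I$ as an $\Omega$-ideal. GS bases of ideals of $\mathbf k\mathcal S(Z)$ are defined in the same way, with contexts $a\star b$, where $a,b$ are possibly empty words on $Z$. Let $X$ be a set and let $\Phi\subseteq\mathbf k\mathfrak S(X)$ be a system of multilinear OPIs: for each $\phi=\phi(x_1,\dots,x_n)\in\Phi$, $n\ge1$, every monomial of $\phi$ contains each of the distinct variables $x_1,\dots,x_n\in X$ exactly once and no other variable. Put $S_\Phi(\mathfrak S(Z))=\{\phi(u_1,\dots,u_n)\mid\phi\in\Phi,\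 u_i\in\mathfrak S(Z)\}$. Let $\bar\phi$ denote the leading monomial of a nonzero $\phi\in\Phi$ with respect to a fixed linear order on $\mathfrak S(X)$. Let $A=\mathbf k\mathcal S(Z)/I_A$ be an algebra with generating set $Z$, where $I_A$ is a two-sided ideal of $\mathbf k\mathcal S(Z)$. **Theorem.** Let $\le$ be a monomial order on $\mathfrak S(Z)$. Assume that $\Phi$ is $\Omega$-GS on $\mathbf k\mathfrak S(Z)$ with respect to $\le$, that is, $S_\Phi(\mathfrak S(Z))$ is an $\Omega$-GS basis in $\mathbf k\mathfrak S(Z)$, and that $G$ is a GS basis of $I_A$ in $\mathbf k\mathcal S(Z)$ with respect to the restriction of $\le$ to $\mathcal S(Z)$. Suppose that for every nonzero $\phi(x_1,\dots,x_n)\in\Phi$ the leading monomial $\bar\phi$ has no subword in $\mathcal S(X)\setminus X$, and that, for all $u_1,\dots,u_n\in\mathfrak S(Z)$, $\phi(u_1,\dots,u_n)$ is zero or has leading monomial $\bar\phi(u_1,\dots,u_n)$. Then $S_\Phi(\mathfrak S(Z))\cup G$ is an $\Omega$-GS basis, with respect to $\le$, of the $\Omega$-ideal $\langle S_\Phi(\mathfrak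 S(Z))\cup I_A\rangle$ generated by $S_\Phi(\mathfrak S(Z))\cup I_A$ in $\mathbf k\mathfrak S(Z)$. -/

import Mathlib

/-! ### The free `Ω`-semigroup -/

/-- The underlying set of the free `Ω`-semigroup `𝔖(Z)`: bracketed nonempty words on `Z`.
A letter is an element `z` of `Z` or a bracketed word `⌊w⌋_ω`; a word is a letter, or a letter
followed by a word. -/
inductive OpWord (Ω Z : Type*) where
  /-- the one-letter word `z` -/
  | var (z : Z) : OpWord Ω Z
  /-- the one-letter word `⌊w⌋_ω` -/
  | op (ω : Ω) (w : OpWord Ω Z) : OpWord Ω Z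
  /-- the word `z w` -/
  | varMul (z : Z) (w : OpWord Ω Z) : OpWord Ω Z
  /-- the word `⌊u⌋_ω w` -/
  | opMul (ω : Ω) (u w : OpWord Ω Z) : OpWord Ω Z

namespace OpWord

/-- Concatenation of words. -/
def concat {Ω Z : Type*} : OpWord Ω Z → OpWord Ω Z → OpWord Ω Z
  | var z, v => varMul z v
  | op ω u, v => opMul ω u v
  | varMul z w, v => varMul z (concat w v)
  | opMul ω u w, v => opMul ω u (concat w v)

instance {Ω Z : Type*} : Mul (OpWord Ω Z) := ⟨concat⟩

theorem concat_assoc {Ω Z : Type*} (a b c : OpWord Ω Z) :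
    concat (concat a b) c = concat a (concat b c) := by
  induction a with
  | var z => rfl
  | op ω w _ => rfl
  | varMul z w ih => simp only [concat, ih]
  | opMul ω u w _ ih => simp only [concat, ih]

instance {Ω Z : Type*} : Semigroup (OpWord Ω Z) where
  mul_assoc := concat_assoc

/-- The extension of `f : Z → S` to the free `Ω`-semigroup, for a semigroup `S` with operators
`P ω`. -/
def lift {Ω Z S : Type*} [Mul S] (P : Ω → S → S) (f : Z → S) : OpWord Ω Z → S
  | var z => f z
  | op ω w => P ω (lift P f w)
  | varMul z w => f z * lift P f w
  | opMul ω u w => P ω (lift P f u) * lift P f w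

/-- The universal property of the free `Ω`-semigroup: `lift P f` is the unique morphism of
`Ω`-semigroups that extends `f`. -/
theorem lift_universal {Ω Z S : Type*} [Semigroup S] (P : Ω → S → S) (f : Z → S)
    (F : OpWord Ω Z → S) :
    ((∀ a b, F (a * b) = F a * F b) ∧ (∀ ω a, F (op ω a) = P ω (F a)) ∧ ∀ z, F (var z) = f z) ↔
      F = lift P f := by
  constructor
  · rintro ⟨h1, h2, h3⟩
    funext a
    induction a with
    | var z => exact h3 z
    | op ω w ih => rw [h2, ih]; rfl
    | varMul z w ih =>
      have := h1 (var z) w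
      rw [h3, ih] at this
      exact this
    | opMul ω u w ihu ihw =>
      have := h1 (op ω u) w
      rw [h2, ihu, ihw] at this
      exact this
  · rintro rfl
    refine ⟨fun a b => ?_, fun _ _ => rfl, fun _ => rfl⟩
    induction a with
    | var z => rfl
    | op ω w _ => rfl
    | varMul z w ih =>
      change f z * lift P f (w * b) = f z * lift P f w * lift P f b
      rw [ih, mul_assoc]
    | opMul ω u w _ ih =>
      change P ω (lift P f u) * lift P f (w * b) = P ω (lift P f u) * lift P f w * lift P f b
      rw [ih, mul_assoc]

/-- The breadth `|u|`: the number of letters (elements of `Z` or brackets) at the outermost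
level. -/
def breadth {Ω Z : Type*} : OpWord Ω Z → ℕ
  | var _ => 1
  | op _ _ => 1
  | varMul _ w => 1 + breadth w
  | opMul _ _ w => 1 + breadth w

/-- The elements of `Z` that occur in a word, at all levels, from left to right and with
repetitions. -/
def letters {Ω Z : Type*} : OpWord Ω Z → List Z
  | var z => [z]
  | op _ w => letters w
  | varMul z w => z :: letters w
  | opMul _ u w => letters u ++ letters w

/-- The inclusion of the free semigroup `𝒮(Z)` in `𝔖(Z)`. -/
def ofWord {Ω Z : Type*} : FreeSemigroup Z → OpWord Ω Z :=
  FreeSemigroup.lift var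

/-- The word `m(σ)` obtained from `m` by replacing every `x` by the word `σ x`. -/
def subst {Ω X Z : Type*} (σ : X → OpWord Ω Z) : OpWord Ω X → OpWord Ω Z :=
  lift op σ

/-- The set `𝔖^⋆(Z)` of the words on `Z ∪ {⋆}` in which `⋆` (here `none`) occurs exactly once. -/
def starWords (Ω Z : Type*) : Set (OpWord Ω (Option Z)) :=
  {q | q.letters.countP Option.isNone = 1}

/-- The word `q|_u` obtained by replacing `⋆` in `q` by `u`. -/
def plug {Ω Z : Type*} (q : OpWord Ω (Option Z)) (u : OpWord Ω Z) : OpWord Ω Z :=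
  subst (fun o => o.elim u var) q

/-- `u` is a subword of `w`, that is, `w = q|_u` for some `q ∈ 𝔖^⋆(Z)`. -/
def IsSubword {Ω Z : Type*} (u w : OpWord Ω Z) : Prop :=
  ∃ q ∈ starWords Ω Z, plug q u = w

end OpWord

/-- `lt` is the strict part of a monomial order on `𝔖(Z)`: a well order with
`u < v ⇒ q|_u < q|_v`. -/
structure IsMonomialOrder {Ω Z : Type*} (lt : OpWord Ω Z → OpWord Ω Z → Prop) : Prop where
  wellOrder : IsWellOrder (OpWord Ω Z) lt
  plug_lt : ∀ u v : OpWord Ω Z, lt u v → ∀ q ∈ OpWord.starWords Ω Z,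
    lt (OpWord.plug q u) (OpWord.plug q v)

/-! ### Gröbner-Shirshov bases

The notions below are stated for a semigroup `S` with a strict order `lt`, a breadth function `br`
and a set `ctx` of contexts, a context being given as the map `u ↦ q|_u`. They are then used for
`𝒮(Z)` with the maps `u ↦ a u b`, and for `𝔖(Z)` with the maps `u ↦ q|_u`, `q ∈ 𝔖^⋆(Z)`. -/

/-- `m` is the leading monomial of `f`: the largest monomial that appears in `f` (there is none if
`f = 0`). -/
def IsLeadingMonomial {k S : Type*} [Field k] (lt : S → S → Prop) (f : MonoidAlgebra k S)
    (m : S) : Prop :=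
  m ∈ f.coeff.support ∧ ∀ m' ∈ f.coeff.support, m' ≠ m → lt m' m

/-- `h` is trivial modulo `(G, p)`: `h = ∑ c_i q_i|_{s_i}` with `s_i ∈ G` and
`q_i|_{s̄_i} < p`. -/
def IsTrivialMod {k S : Type*} [Field k] [Semigroup S] (ctx : Set (S → S)) (lt : S → S → Prop)
    (G : Set (MonoidAlgebra k S)) (p : S) (h : MonoidAlgebra k S) : Prop :=
  h ∈ Submodule.span k {x | ∃ q ∈ ctx, ∃ s ∈ G, ∃ m, IsLeadingMonomial lt s m ∧ lt (q m) p ∧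
    x = MonoidAlgebra.mapDomain q s}

/-- All intersection and inclusion compositions of (nonzero) elements of `G`, divided by their
leading coefficients, are trivial. -/
def IsGSBasis {k S : Type*} [Field k] [Semigroup S] (ctx : Set (S → S)) (br : S → ℕ)
    (lt : S → S → Prop) (G : Set (MonoidAlgebra k S)) : Prop :=
  ∀ f₀ ∈ G, ∀ g₀ ∈ G, ∀ a b : S, IsLeadingMonomial lt f₀ a → IsLeadingMonomial lt g₀ b →
    ∀ f g : MonoidAlgebra k S, f = (f₀.coeff a)⁻¹ • f₀ → g = (g₀.coeff b)⁻¹ • g₀ →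
      (∀ p u v : S, p = a * u → p = v * b → max (br a) (br b) < br p → br p < br a + br b →
        IsTrivialMod ctx lt G p
          (f * MonoidAlgebra.single u (1 : k) - MonoidAlgebra.single v (1 : k) * g)) ∧
      (∀ q ∈ ctx, ∀ p : S, p = a → p = q b →
        IsTrivialMod ctx lt G p (f - MonoidAlgebra.mapDomain q g))

/-- `I` is a two-sided ideal of the nonunital algebra `k S`. -/
def IsAlgIdeal {k S : Type*} [Field k] [Semigroup S] (I : Submodule k (MonoidAlgebra k S)) :
    Prop :=
  ∀ x ∈ I, ∀ a : MonoidAlgebra k S, a * x ∈ I ∧ x * a ∈ I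

/-- The two-sided ideal of `k S` generated by `T`. -/
noncomputable def algIdealSpan {k S : Type*} [Field k] [Semigroup S] (T : Set (MonoidAlgebra k S)) :
    Submodule k (MonoidAlgebra k S) :=
  sInf {I | IsAlgIdeal I ∧ T ⊆ I}

/-! ### The associative case: `k𝒮(Z)` -/

/-- The maps `u ↦ a u b` with `a` and `b` in the free monoid `ℳ(Z) = 𝒮(Z) ∪ {1}`. -/
def wordContexts (Z : Type*) : Set (FreeSemigroup Z → FreeSemigroup Z) :=
  {c | ∃ a b : WithOne (FreeSemigroup Z), ∀ u, (c u : WithOne (FreeSemigroup Z)) = a * u * b}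

/-- `G` is a Gröbner-Shirshov basis of the ideal `I` in `k𝒮(Z)`. -/
def IsGSBasisOf {k Z : Type*} [Field k] (lt : FreeSemigroup Z → FreeSemigroup Z → Prop)
    (G : Set (MonoidAlgebra k (FreeSemigroup Z)))
    (I : Submodule k (MonoidAlgebra k (FreeSemigroup Z))) : Prop :=
  IsGSBasis (wordContexts Z) FreeSemigroup.length lt G ∧ algIdealSpan G = I

/-! ### The operated case: `k𝔖(Z)` -/

/-- The maps `u ↦ q|_u` with `q ∈ 𝔖^⋆(Z)`. -/
def opContexts (Ω Z : Type*) : Set (OpWord Ω Z → OpWord Ω Z) :=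
  {c | ∃ q ∈ OpWord.starWords Ω Z, c = OpWord.plug q}

/-- `G` is an `Ω`-GS basis in `k𝔖(Z)`. -/
def IsOmegaGSBasis {k Ω Z : Type*} [Field k] (lt : OpWord Ω Z → OpWord Ω Z → Prop)
    (G : Set (MonoidAlgebra k (OpWord Ω Z))) : Prop :=
  IsGSBasis (opContexts Ω Z) OpWord.breadth lt G

/-- `I` is an `Ω`-ideal of `k𝔖(Z)`: an ideal closed under the linear operators `P_ω` with
`P_ω(w) = ⌊w⌋_ω`. -/
def IsOmegaIdeal {k Ω Z : Type*} [Field k] (I : Submodule k (MonoidAlgebra k (OpWord Ω Z))) :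
    Prop :=
  IsAlgIdeal I ∧ ∀ ω : Ω, ∀ x ∈ I, MonoidAlgebra.mapDomain (OpWord.op ω) x ∈ I

/-- The `Ω`-ideal `⟨T⟩` of `k𝔖(Z)` generated by `T`. -/
noncomputable def omegaIdealSpan {k Ω Z : Type*} [Field k] (T : Set (MonoidAlgebra k (OpWord Ω Z))) :
    Submodule k (MonoidAlgebra k (OpWord Ω Z)) :=
  sInf {I | IsOmegaIdeal I ∧ T ⊆ I}

/-- `G` is an `Ω`-GS basis of the `Ω`-ideal `I` in `k𝔖(Z)`. -/
def IsOmegaGSBasisOf {k Ω Z : Type*} [Field k] (lt : OpWord Ω Z → OpWord Ω Z → Prop)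
    (G : Set (MonoidAlgebra k (OpWord Ω Z)))
    (I : Submodule k (MonoidAlgebra k (OpWord Ω Z))) : Prop :=
  IsOmegaGSBasis lt G ∧ omegaIdealSpan G = I

/-! ### Operated polynomial identities -/

/-- `φ ∈ k𝔖(X)` is a (multilinear) OPI `φ(x_1, …, x_n)`, `n ≥ 1`: there are distinct variables
`x_1, …, x_n` such that each monomial of `φ` contains each `x_i` exactly once, and no other
variable. -/
def IsOPI {k Ω X : Type*} [Field k] (φ : MonoidAlgebra k (OpWord Ω X)) : Prop :=
  ∃ V : Finset X, V.Nonempty ∧ ∀ m ∈ φ.coeff.support, (m.letters : Multiset X) = V.val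

/-- `φ(u_1, …, u_n) ∈ k𝔖(Z)`, where `u_i = σ x_i`. -/
noncomputable def opiEval {k Ω X Z : Type*} [Field k] (φ : MonoidAlgebra k (OpWord Ω X))
    (σ : X → OpWord Ω Z) : MonoidAlgebra k (OpWord Ω Z) :=
  MonoidAlgebra.mapDomain (OpWord.subst σ) φ

/-- `S_Φ(𝔖(Z))`: all `φ(u_1, …, u_n)` with `φ ∈ Φ` and `u_i ∈ 𝔖(Z)`. -/
def opiInstances {k Ω X : Type*} [Field k] (Φ : Set (MonoidAlgebra k (OpWord Ω X)))
    (Z : Type*) : Set (MonoidAlgebra k (OpWord Ω Z)) :=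
  {f | ∃ φ ∈ Φ, ∃ σ : X → OpWord Ω Z, f = opiEval φ σ}

/-- `Φ` is `Ω`-GS on `k𝔖(Z)` with respect to `lt`. -/
def IsOmegaGS {k Ω X Z : Type*} [Field k] (Φ : Set (MonoidAlgebra k (OpWord Ω X)))
    (lt : OpWord Ω Z → OpWord Ω Z → Prop) : Prop :=
  IsOmegaGSBasis lt (opiInstances Φ Z)

/-! Compositions inside `opiInstances Φ Z` are trivial because Φ is Ω-GS. Those inside `G` stay
trivial in 𝔖(Z): their leading monomials contain no bracket (they are pure), and a pure word has
only pure subwords (`isOmegaGSBasis_image_ofWord`). The claim about ideals is formal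
(`omegaIdealSpan_union_algIdealSpan`). The work lies in the mixed compositions of φ(σ) with g ∈ `G`,
taken monic, with pure leading monomial b.

Let m be the leading monomial of φ and p = m(σ) = c(b). As no two variables are adjacent in m, the
occurrence of b lies inside a single value σ x = r(b) (`exists_occurrence`). Let F(m', y) be m' with
r(y) in place of σ x, and extend F bilinearly to E = F(φ, g). Expanded along g, E is φ(σ) plus
instances of φ with leading monomials below p. Expanded along φ, E lies in the Ω-ideal generated by
`G`. So, up to smaller instances of φ, the composition is an element of that ideal all of whose
monomials are below p. The single summands of the expansion along φ are not known to lie below p,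
since other monomials of φ may become large and cancel; hence the Composition-Diamond lemma for `G`
is needed (`isResolved_of_isPure`, `IsResolved.mem_levelSpan`). This proves `IsOPI.agree_inclusion`.

The other mixed compositions reduce to this one (`IsOPI.agree`). In an intersection the overlap is
pure, so m(σ) meets it at a variable of m; that variable occurs once and absorbs the extra factor,
so p = m(σ') for another substitution σ'. If m(σ) is a subword of b, then m is a variable, and again
p = m(σ'). Both terms of the composition are then compared with φ(σ').

This comparison needs φ(σ') ≠ 0, although the hypothesis allows φ to vanish on some arguments.
Vanishing is excluded by `OpWord.subst_ne_subst`: if another monomial m' of φ satisfied m'(σ) =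
m(σ), relabelling the letters of σ would yield an infinite descent in the well order. -/

namespace OpWord

/-! ### Words as lists of outermost letters, and substitution. -/

section Letters

variable {Ω X Y Z : Type*}

@[simp] theorem var_mul (z : Z) (w : OpWord Ω Z) : var z * w = varMul z w := rfl
@[simp] theorem op_mul (ω : Ω) (u w : OpWord Ω Z) : op ω u * w = opMul ω u w := rfl
@[simp] theorem varMul_mul (z : Z) (u w : OpWord Ω Z) : varMul z u * w = varMul z (u * w) := rfl
@[simp] theorem opMul_mul (ω : Ω) (t u w : OpWord Ω Z) : opMul ω t u * w = opMul ω t (u * w) := rfl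

/-- The list of the outermost letters of a word. -/
def toList : OpWord Ω Z → List (Z ⊕ Ω × OpWord Ω Z)
  | var z => [Sum.inl z]
  | op ω w => [Sum.inr (ω, w)]
  | varMul z w => Sum.inl z :: toList w
  | opMul ω u w => Sum.inr (ω, u) :: toList w

@[simp] theorem toList_var (z : Z) : toList (var z : OpWord Ω Z) = [Sum.inl z] := rfl
@[simp] theorem toList_op (ω : Ω) (w : OpWord Ω Z) : toList (op ω w) = [Sum.inr (ω, w)] := rfl
@[simp] theorem toList_varMul (z : Z) (w : OpWord Ω Z) :
    toList (varMul z w) = Sum.inl z :: toList w := rfl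
@[simp] theorem toList_opMul (ω : Ω) (u w : OpWord Ω Z) :
    toList (opMul ω u w) = Sum.inr (ω, u) :: toList w := rfl

@[simp] theorem toList_ne_nil (w : OpWord Ω Z) : toList w ≠ [] := by
  cases w <;> simp

@[simp] theorem toList_mul (u v : OpWord Ω Z) : toList (u * v) = toList u ++ toList v := by
  induction u with
  | var z => rfl
  | op ω w _ => rfl
  | varMul z w ih => simp [ih]
  | opMul ω t w _ ih => simp [ih]

theorem toList_injective : Function.Injective (toList : OpWord Ω Z → _) := by
  intro u
  induction u with
  | var z => intro v h; cases v <;> simp_all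
  | op ω w _ => intro v h; cases v <;> simp_all
  | varMul z w ih =>
    intro v h
    cases v <;> simp at h
    simp [h.1, ih h.2]
  | opMul ω t w _ ih =>
    intro v h
    cases v <;> simp at h
    simp [h.1, ih h.2]

theorem toList_inj {u v : OpWord Ω Z} : toList u = toList v ↔ u = v := toList_injective.eq_iff

theorem breadth_eq_length (w : OpWord Ω Z) : w.breadth = (toList w).length := by
  induction w with
  | var z => rfl
  | op ω w _ => rfl
  | varMul z w ih => simp [breadth, ih, add_comm]
  | opMul ω t w _ ih => simp [breadth, ih, add_comm]

/-- The one-letter word of a letter. -/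
def ofLetter : Z ⊕ Ω × OpWord Ω Z → OpWord Ω Z
  | Sum.inl z => var z
  | Sum.inr (ω, w) => op ω w

@[simp] theorem toList_ofLetter (l : Z ⊕ Ω × OpWord Ω Z) : toList (ofLetter l) = [l] := by
  rcases l with z | ⟨ω, w⟩ <;> rfl

theorem exists_toList_eq {L : List (Z ⊕ Ω × OpWord Ω Z)} (hL : L ≠ []) :
    ∃ w : OpWord Ω Z, toList w = L := by
  induction L with
  | nil => exact absurd rfl hL
  | cons l L ih =>
    by_cases h : L = []
    · exact ⟨ofLetter l, by simp [h]⟩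
    · obtain ⟨w, hw⟩ := ih h
      exact ⟨ofLetter l * w, by simp [hw]⟩

/-- The word `A u B` for lists of letters `A` and `B`. -/
def wrap (A : List (Z ⊕ Ω × OpWord Ω Z)) (u : OpWord Ω Z) (B : List (Z ⊕ Ω × OpWord Ω Z)) :
    OpWord Ω Z :=
  A.foldr (fun l w => ofLetter l * w) (B.foldl (fun w l => w * ofLetter l) u)

@[simp] theorem toList_wrap (A : List (Z ⊕ Ω × OpWord Ω Z)) (u : OpWord Ω Z)
    (B : List (Z ⊕ Ω × OpWord Ω Z)) : toList (wrap A u B) = A ++ toList u ++ B := by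
  have h : ∀ u : OpWord Ω Z, toList (B.foldl (fun w l => w * ofLetter l) u) = toList u ++ B := by
    induction B with
    | nil => simp
    | cons l B ih => intro u; simp [ih]
  induction A with
  | nil => simpa [wrap] using h u
  | cons l A ih => simpa [wrap] using ih

@[simp] theorem letters_mul (u v : OpWord Ω Z) : letters (u * v) = letters u ++ letters v := by
  induction u with
  | var z => rfl
  | op ω w _ => rfl
  | varMul z w ih => simp [letters, ih]
  | opMul ω t w _ ih => simp [letters, ih]

@[simp] theorem subst_var (σ : X → OpWord Ω Z) (x : X) : subst σ (var x) = σ x := rfl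
@[simp] theorem subst_op (σ : X → OpWord Ω Z) (ω : Ω) (w : OpWord Ω X) :
    subst σ (op ω w) = op ω (subst σ w) := rfl
@[simp] theorem subst_varMul (σ : X → OpWord Ω Z) (x : X) (w : OpWord Ω X) :
    subst σ (varMul x w) = σ x * subst σ w := rfl
@[simp] theorem subst_opMul (σ : X → OpWord Ω Z) (ω : Ω) (u w : OpWord Ω X) :
    subst σ (opMul ω u w) = opMul ω (subst σ u) (subst σ w) := rfl

@[simp] theorem subst_mul (σ : X → OpWord Ω Z) (u v : OpWord Ω X) :
    subst σ (u * v) = subst σ u * subst σ v := by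
  induction u with
  | var z => rfl
  | op ω w _ => rfl
  | varMul z w ih => simp [ih, mul_assoc]
  | opMul ω t w _ ih => simp [ih]

theorem subst_subst (τ : Y → OpWord Ω Z) (σ : X → OpWord Ω Y) (w : OpWord Ω X) :
    subst τ (subst σ w) = subst (fun x => subst τ (σ x)) w := by
  induction w with
  | var z => rfl
  | op ω w ih => simp [ih]
  | varMul z w ih => simp [ih]
  | opMul ω t w ih' ih => simp [ih, ih']

theorem subst_congr {σ τ : X → OpWord Ω Z} {w : OpWord Ω X} (h : ∀ x ∈ w.letters, σ x = τ x) :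
    subst σ w = subst τ w := by
  induction w with
  | var z => exact h z (by simp [letters])
  | op ω w ih => simp [ih h]
  | varMul z w ih => simp [ih (fun x hx => h x (by simp [letters, hx])), h z (by simp [letters])]
  | opMul ω t w ih' ih =>
    simp [ih (fun x hx => h x (by simp [letters, hx])),
      ih' (fun x hx => h x (by simp [letters, hx]))]

theorem letters_subst (σ : X → OpWord Ω Z) (w : OpWord Ω X) :
    letters (subst σ w) = w.letters.flatMap fun x => letters (σ x) := by
  induction w with
  | var z => simp [letters]
  | op ω w ih => simpa [letters] using ih
  | varMul z w ih => simp [letters, ih]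
  | opMul ω t w ih' ih => simp [letters, ih, ih']

theorem letters_ne_nil (w : OpWord Ω Z) : letters w ≠ [] := by
  induction w with
  | opMul ω t w ih' ih => simp [letters, ih']
  | _ => simp_all [letters]

theorem letters_eq_flatMap_toList (w : OpWord Ω Z) :
    letters w = (toList w).flatMap fun l => letters (ofLetter l) := by
  induction w with
  | var z => simp [letters, ofLetter]
  | op ω w _ => simp [letters, ofLetter]
  | varMul z w ih => simp [letters, ofLetter, ih]
  | opMul ω t w _ ih => simp [letters, ofLetter, ih]

theorem subst_update_of_notMem [DecidableEq X] {x : X} {w : OpWord Ω X} (hx : x ∉ w.letters)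
    (σ : X → OpWord Ω Z) (u : OpWord Ω Z) : subst (Function.update σ x u) w = subst σ w :=
  subst_congr fun y hy => Function.update_of_ne (by rintro rfl; exact hx hy) _ _

end Letters

/-! ### Contexts -/

section Contexts

variable {Ω X Z : Type*}

/-- The maps `u ↦ A u B` and `u ↦ A ⌊c u⌋_ω B` with a context `c`. -/
inductive IsContext : (OpWord Ω Z → OpWord Ω Z) → Prop
  | base (c : OpWord Ω Z → OpWord Ω Z) (A B : List (Z ⊕ Ω × OpWord Ω Z))
    (h : ∀ u, toList (c u) = A ++ toList u ++ B) : IsContext c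
  | nest (c c' : OpWord Ω Z → OpWord Ω Z) (A B : List (Z ⊕ Ω × OpWord Ω Z)) (ω : Ω)
    (h' : IsContext c') (h : ∀ u, toList (c u) = A ++ [Sum.inr (ω, c' u)] ++ B) : IsContext c

theorem isContext_id : IsContext (id : OpWord Ω Z → OpWord Ω Z) :=
  .base _ [] [] (by simp)

theorem IsContext.wrap {c : OpWord Ω Z → OpWord Ω Z} (hc : IsContext c)
    (A B : List (Z ⊕ Ω × OpWord Ω Z)) : IsContext fun u => wrap A (c u) B := by
  cases hc with
  | base _ A' B' h => exact .base _ (A ++ A') (B' ++ B) (by simp [h])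
  | nest _ c' A' B' ω h' h => exact .nest _ c' (A ++ A') (B' ++ B) ω h' (by simp [h])

theorem IsContext.op {c : OpWord Ω Z → OpWord Ω Z} (hc : IsContext c) (ω : Ω) :
    IsContext fun u => op ω (c u) :=
  .nest _ c [] [] ω hc (by simp)

theorem IsContext.mul_left {c : OpWord Ω Z → OpWord Ω Z} (hc : IsContext c) (v : OpWord Ω Z) :
    IsContext fun u => v * c u := by
  convert hc.wrap (toList v) [] using 2
  simp [← toList_inj]

theorem IsContext.mul_right {c : OpWord Ω Z → OpWord Ω Z} (hc : IsContext c) (v : OpWord Ω Z) :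
    IsContext fun u => c u * v := by
  convert hc.wrap [] (toList v) using 2
  simp [← toList_inj]

theorem IsContext.comp {c d : OpWord Ω Z → OpWord Ω Z} (hc : IsContext c) (hd : IsContext d) :
    IsContext (c ∘ d) := by
  induction hc with
  | base c A B h =>
    convert hd.wrap A B using 2
    simp [← toList_inj, h]
  | nest c c' A B ω h' h ih => exact .nest _ (c' ∘ d) A B ω ih (by simp [h])

theorem plug_eq_of_countP_eq_zero {q : OpWord Ω (Option Z)}
    (hq : q.letters.countP Option.isNone = 0) : ∃ w : OpWord Ω Z, ∀ u, plug q u = w := by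
  induction q with
  | var z =>
    cases z with
    | none => simp [letters] at hq
    | some z => exact ⟨var z, fun u => rfl⟩
  | op ω q ih =>
    obtain ⟨w, hw⟩ := ih hq
    exact ⟨op ω w, fun u => congrArg (OpWord.op ω) (hw u)⟩
  | varMul z q ih =>
    cases z with
    | none => simp [letters] at hq
    | some z =>
      obtain ⟨w, hw⟩ := ih (by simpa [letters] using hq)
      exact ⟨varMul z w, fun u => congrArg (varMul z) (hw u)⟩
  | opMul ω t q ih' ih =>
    simp only [letters, List.countP_append, Nat.add_eq_zero_iff] at hq
    obtain ⟨w, hw⟩ := ih hq.2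
    obtain ⟨w', hw'⟩ := ih' hq.1
    exact ⟨opMul ω w' w, fun u => congrArg₂ (opMul ω) (hw' u) (hw u)⟩

theorem isContext_plug {q : OpWord Ω (Option Z)} (hq : q ∈ starWords Ω Z) :
    IsContext (plug q) := by
  change q.letters.countP Option.isNone = 1 at hq
  induction q with
  | var z =>
    cases z with
    | none => exact isContext_id
    | some z => simp [letters] at hq
  | op ω q ih => exact (ih hq).op ω
  | varMul z q ih =>
    cases z with
    | none =>
      obtain ⟨w, hw⟩ := plug_eq_of_countP_eq_zero (q := q) (by simpa [letters] using hq)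
      convert isContext_id.mul_right w using 2 with u
      exact congrArg (u * ·) (hw u)
    | some z => exact (ih (by simpa [letters] using hq)).mul_left (var z)
  | opMul ω t q ih' ih =>
    simp only [letters, List.countP_append] at hq
    rcases Nat.add_eq_one_iff.1 hq with ⟨h1, h2⟩ | ⟨h1, h2⟩
    · obtain ⟨w, hw⟩ := plug_eq_of_countP_eq_zero h1
      convert (ih h2).mul_left (OpWord.op ω w) using 2 with u
      exact congrArg (opMul ω · (plug q u)) (hw u)
    · obtain ⟨w, hw⟩ := plug_eq_of_countP_eq_zero h2
      convert ((ih' h1).op ω).mul_right w using 2 with u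
      exact congrArg (opMul ω (plug t u) ·) (hw u)

/-- A word on `Z` as a word on `Z ∪ {⋆}`. -/
def constStar (w : OpWord Ω Z) : OpWord Ω (Option Z) := subst (fun z => var (some z)) w

theorem countP_constStar (w : OpWord Ω Z) : (constStar w).letters.countP Option.isNone = 0 := by
  rw [constStar, letters_subst, List.countP_eq_zero]
  simp only [List.mem_flatMap, letters, List.mem_singleton]
  rintro _ ⟨z, -, rfl⟩
  simp

theorem subst_var_self (w : OpWord Ω Z) : subst var w = w := by
  induction w with
  | var z => rfl
  | op ω w ih => simp [ih]
  | varMul z w ih => simp [ih]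
  | opMul ω t w ih' ih => simp [ih, ih']

theorem plug_constStar (w u : OpWord Ω Z) : plug (constStar w) u = w := by
  rw [plug, constStar, subst_subst]
  exact subst_var_self w

theorem exists_plug_mul_left {q : OpWord Ω (Option Z)} (hq : q ∈ starWords Ω Z)
    (w : OpWord Ω Z) : ∃ q' ∈ starWords Ω Z, ∀ u, plug q' u = w * plug q u := by
  refine ⟨constStar w * q, ?_, fun u => ?_⟩
  · change List.countP _ _ = 1 at hq ⊢
    simp [countP_constStar, hq]
  · conv_rhs => rw [← plug_constStar w u]
    exact subst_mul _ _ _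

theorem exists_plug_mul_right {q : OpWord Ω (Option Z)} (hq : q ∈ starWords Ω Z)
    (w : OpWord Ω Z) : ∃ q' ∈ starWords Ω Z, ∀ u, plug q' u = plug q u * w := by
  refine ⟨q * constStar w, ?_, fun u => ?_⟩
  · change List.countP _ _ = 1 at hq ⊢
    simp [countP_constStar, hq]
  · conv_rhs => rw [← plug_constStar w u]
    exact subst_mul _ _ _

theorem exists_plug_wrap {q : OpWord Ω (Option Z)} (hq : q ∈ starWords Ω Z)
    (A B : List (Z ⊕ Ω × OpWord Ω Z)) :
    ∃ q' ∈ starWords Ω Z, ∀ u, plug q' u = wrap A (plug q u) B := by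
  induction A with
  | cons l A ih =>
    obtain ⟨q', hq', h⟩ := ih
    obtain ⟨q'', hq'', h'⟩ := exists_plug_mul_left hq' (ofLetter l)
    exact ⟨q'', hq'', fun u => by rw [h', h]; rfl⟩
  | nil =>
    induction B generalizing q with
    | nil => exact ⟨q, hq, fun u => rfl⟩
    | cons l B ih =>
      obtain ⟨q', hq', h⟩ := exists_plug_mul_right hq (ofLetter l)
      obtain ⟨q'', hq'', h'⟩ := ih hq'
      exact ⟨q'', hq'', fun u => by rw [h', h]; rfl⟩

theorem IsContext.exists_plug {c : OpWord Ω Z → OpWord Ω Z} (hc : IsContext c) :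
    ∃ q ∈ starWords Ω Z, c = plug q := by
  induction hc with
  | base c A B h =>
    obtain ⟨q, hq, h'⟩ := exists_plug_wrap (Ω := Ω) (Z := Z) (q := var none) (by rfl) A B
    refine ⟨q, hq, funext fun u => ?_⟩
    rw [h', ← toList_inj, h, toList_wrap]
    rfl
  | nest c c' A B ω h' h ih =>
    obtain ⟨q, hq, rfl⟩ := ih
    obtain ⟨q', hq', h''⟩ := exists_plug_wrap (q := OpWord.op ω q) (by exact hq) A B
    refine ⟨q', hq', funext fun u => ?_⟩
    rw [h'', ← toList_inj, h, toList_wrap]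
    rfl

/-- The inductive form records where the hole sits, either at the outermost level or in a definite
bracket. This is what all comparisons of two occurrences use. -/
theorem mem_opContexts {c : OpWord Ω Z → OpWord Ω Z} : c ∈ opContexts Ω Z ↔ IsContext c :=
  ⟨fun ⟨_, hq, h⟩ => h ▸ isContext_plug hq, fun h => h.exists_plug⟩

end Contexts

end OpWord

/-- The hypothesis `hK` forbids the block `K` to straddle the cut between `U` and `V`, so one side
contains it. -/
theorem List.split_of_append_eq_append {α : Type*} {A K B U V : List α} (h : A ++ K ++ B = U ++ V)
    (hK : ∀ K₁ K₂, K₁ ≠ [] → K₂ ≠ [] → K = K₁ ++ K₂ → K₁ <:+ U → K₂ <+: V → False) :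
    (∃ B', U = A ++ K ++ B' ∧ B = B' ++ V) ∨ ∃ A', V = A' ++ K ++ B ∧ A = U ++ A' := by
  rcases List.append_eq_append_iff.1 h with ⟨B', h1, h2⟩ | ⟨C, h1, h2⟩
  · exact .inl ⟨B', h1, h2⟩
  · rcases List.append_eq_append_iff.1 h1 with ⟨D, h3, h4⟩ | ⟨A', h3, h4⟩
    · by_cases hD : D = []
      · exact .inr ⟨[], by simp_all, by simp_all⟩
      by_cases hC : C = []
      · exact .inl ⟨[], by simp_all, by simp_all⟩
      exact (hK D C hD hC h4 ⟨A, h3.symm⟩ ⟨B, h2.symm⟩).elim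
    · exact .inr ⟨A', by rw [h2, h4], h3⟩

namespace OpWord

/-! ### Pure subwords of substituted monomials. -/

section Occurrences

variable {Ω X Z : Type*}

/-- All outermost letters of `w` are elements of `Z`. -/
def IsPure (w : OpWord Ω Z) : Prop := ∀ l ∈ toList w, l.isLeft

/-- The first letter is a bracket. -/
def StartsOp (w : OpWord Ω Z) : Prop := ∃ l L, toList w = Sum.inr l :: L

/-- The last letter is a bracket. -/
def EndsOp (w : OpWord Ω Z) : Prop := ∃ l L, toList w = L ++ [Sum.inr l]

/-- No two elements of `Z` are adjacent letters, at any level. -/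
def NoAdj : OpWord Ω Z → Prop
  | var _ => True
  | op _ w => NoAdj w
  | varMul _ w => StartsOp w ∧ NoAdj w
  | opMul _ u w => NoAdj u ∧ NoAdj w

theorem StartsOp.subst {w : OpWord Ω X} (hw : StartsOp w) (σ : X → OpWord Ω Z) :
    StartsOp (subst σ w) := by
  obtain ⟨l, L, h⟩ := hw
  cases w with
  | op ω w => exact ⟨_, _, rfl⟩
  | opMul ω u w => exact ⟨_, _, rfl⟩
  | _ => simp at h

theorem ofWord_of (z : Z) : (ofWord (FreeSemigroup.of z) : OpWord Ω Z) = var z := rfl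

theorem ofWord_mul (u v : FreeSemigroup Z) : (ofWord (u * v) : OpWord Ω Z) = ofWord u * ofWord v :=
  map_mul _ _ _

/-- Two adjacent variables would form a subword of length two in the free semigroup. -/
theorem noAdj_of_subwords {m : OpWord Ω X}
    (h : ∀ c : OpWord Ω X → OpWord Ω X, IsContext c → ∀ v : FreeSemigroup X, c (ofWord v) = m →
      ∃ x, v = FreeSemigroup.of x) : NoAdj m := by
  induction m with
  | var x => trivial
  | op ω w ih => exact ih fun c hc v hv => h _ (hc.op ω) v (by simp [hv])
  | varMul x w ih =>
    refine ⟨?_, ih fun c hc v hv => h _ (hc.mul_left (var x)) v (by simp [hv])⟩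
    have key : ∀ y, ∀ c : OpWord Ω X → OpWord Ω X, IsContext c →
        c (var x * var y) = varMul x w → False := by
      intro y c hc hw
      obtain ⟨z, hz⟩ := h c hc (FreeSemigroup.of x * FreeSemigroup.of y) hw
      have := congrArg FreeSemigroup.length hz
      simp at this
    cases w with
    | var y => exact (key y _ isContext_id rfl).elim
    | varMul y w => exact (key y _ (isContext_id.mul_right w) rfl).elim
    | op ω w => exact ⟨_, _, rfl⟩
    | opMul ω u w => exact ⟨_, _, rfl⟩
  | opMul ω u w ih' ih =>
    exact ⟨ih' fun c hc v hv => h _ ((hc.op ω).mul_right w) v (by simp [hv]),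
      ih fun c hc v hv => h _ (hc.mul_left (OpWord.op ω u)) v (by simp [hv])⟩

/-- A pure block straddling the cut would contain the bracket next to it, and a bracket that
encloses `b` is a single letter, which cannot be cut. -/
theorem IsContext.split {c : OpWord Ω Z → OpWord Ω Z} (hc : IsContext c) {b U V : OpWord Ω Z}
    (hb : IsPure b) (h : c b = U * V) (hUV : EndsOp U ∨ StartsOp V) :
    (∃ c', IsContext c' ∧ c' b = U ∧ ∀ y, c y = c' y * V) ∨
      ∃ c', IsContext c' ∧ c' b = V ∧ ∀ y, c y = U * c' y := by
  have h' := congrArg toList h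
  rw [toList_mul] at h'
  cases hc with
  | base _ A B hc =>
    rw [hc] at h'
    refine (List.split_of_append_eq_append h' ?_).imp ?_ ?_
    · rintro K₁ K₂ h1 h2 hK ⟨A', hA⟩ ⟨B', hB⟩
      rcases hUV with ⟨l, L, hL⟩ | ⟨l, L, hL⟩
      · obtain ⟨K₁, k, rfl⟩ := (List.eq_nil_or_concat' K₁).resolve_left h1
        rw [hL, ← List.append_assoc] at hA
        obtain rfl : k = Sum.inr l := by simpa using (List.append_inj' hA rfl).2
        have := hb (Sum.inr l) (by simp [hK])
        simp at this
      · obtain ⟨k, K₂, rfl⟩ := List.exists_cons_of_ne_nil h2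
        rw [hL, List.cons_append, List.cons_eq_cons] at hB
        have := hb (Sum.inr l) (by simp [hK, hB.1])
        simp at this
    · rintro ⟨B', h1, h2⟩
      exact ⟨fun y => OpWord.wrap A y B', isContext_id.wrap A B', by simp [← toList_inj, h1],
        fun y => by simp [← toList_inj, hc, h2]⟩
    · rintro ⟨A', h1, h2⟩
      exact ⟨fun y => OpWord.wrap A' y B, isContext_id.wrap A' B, by simp [← toList_inj, h1],
        fun y => by simp [← toList_inj, hc, h2]⟩
  | nest _ c' A B ω hc' hc =>
    rw [hc] at h'
    refine (List.split_of_append_eq_append h' ?_).imp ?_ ?_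
    · rintro K₁ K₂ h1 h2 hK - -
      have := congrArg List.length hK
      have h1 := List.length_pos_iff.2 h1
      have h2 := List.length_pos_iff.2 h2
      simp at this
      omega
    · rintro ⟨B', h1, h2⟩
      exact ⟨fun y => OpWord.wrap A (OpWord.op ω (c' y)) B', (hc'.op ω).wrap A B',
        by simp [← toList_inj, h1], fun y => by simp [← toList_inj, hc, h2]⟩
    · rintro ⟨A', h1, h2⟩
      exact ⟨fun y => OpWord.wrap A' (OpWord.op ω (c' y)) B, (hc'.op ω).wrap A' B,
        by simp [← toList_inj, h1], fun y => by simp [← toList_inj, hc, h2]⟩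

/-- A pure word cannot be the bracket itself, so the occurrence is inside it. -/
theorem IsContext.of_eq_op {c : OpWord Ω Z → OpWord Ω Z} (hc : IsContext c) {b v : OpWord Ω Z}
    {ω : Ω} (hb : IsPure b) (h : c b = OpWord.op ω v) :
    ∃ c', IsContext c' ∧ c' b = v ∧ ∀ y, c y = OpWord.op ω (c' y) := by
  have h' := congrArg toList h
  cases hc with
  | base _ A B hc =>
    rw [hc, toList_op] at h'
    have hl : ∀ l ∈ toList b, l = Sum.inr (ω, v) := fun l hl => by
      have : l ∈ A ++ toList b ++ B := by simp [hl]
      simpa [h'] using this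
    obtain ⟨l, L, hL⟩ := List.exists_cons_of_ne_nil (toList_ne_nil b)
    have h1 := hl l (by simp [hL])
    have h2 := hb l (by simp [hL])
    simp [h1] at h2
  | nest _ c' A B ω' hc' hc =>
    rw [hc, toList_op] at h'
    have hlen := congrArg List.length h'
    simp at hlen
    obtain rfl : A = [] := List.length_eq_zero_iff.1 (by omega)
    obtain rfl : B = [] := List.length_eq_zero_iff.1 (by omega)
    simp at h'
    obtain ⟨rfl, h'⟩ := h'
    exact ⟨c', hc', h', fun y => by simp [← toList_inj, hc]⟩

open Classical in
/-- A pure subword of `m(σ)` lies in `σ x` for some variable `x` of `m`, if no two variables are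
adjacent in `m`. -/
theorem exists_occurrence {m : OpWord Ω X} (hm : NoAdj m) (hnd : m.letters.Nodup)
    {c : OpWord Ω Z → OpWord Ω Z} (hc : IsContext c) {b : OpWord Ω Z} (hb : IsPure b)
    {σ : X → OpWord Ω Z} (h : c b = subst σ m) :
    ∃ x ∈ m.letters, ∃ r, IsContext r ∧ σ x = r b ∧
      ∀ y, subst (Function.update σ x (r y)) m = c y := by
  induction m generalizing c with
  | var x => exact ⟨x, by simp [letters], c, hc, h.symm, fun y => by simp⟩
  | op ω w ih =>
    obtain ⟨c', hc', h', hy⟩ := hc.of_eq_op hb h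
    obtain ⟨x, hx, r, hr, hσ, hy'⟩ := ih hm hnd hc' h'
    exact ⟨x, hx, r, hr, hσ, fun y => by simp [hy, hy']⟩
  | varMul x w ih =>
    simp only [letters, List.nodup_cons] at hnd
    rcases hc.split (V := subst σ w) hb h (.inr (hm.1.subst σ)) with ⟨c', hc', h', hy⟩ | ⟨c', hc', h', hy⟩
    · exact ⟨x, by simp [letters], c', hc', h'.symm, fun y => by
        simp [hy, subst_update_of_notMem hnd.1]⟩
    · obtain ⟨x', hx, r, hr, hσ, hy'⟩ := ih hm.2 hnd.2 hc' h'
      refine ⟨x', by simp [letters, hx], r, hr, hσ, fun y => ?_⟩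
      have : x ≠ x' := by rintro rfl; exact hnd.1 hx
      simp [hy, hy', Function.update_of_ne this]
  | opMul ω u w ih' ih =>
    simp only [letters, List.nodup_append'] at hnd
    rcases hc.split (U := OpWord.op ω (subst σ u)) (V := subst σ w) hb h (.inl ⟨_, [], rfl⟩) with
      ⟨c', hc', h', hy⟩ | ⟨c', hc', h', hy⟩
    · obtain ⟨c'', hc'', h'', hy''⟩ := hc'.of_eq_op hb h'
      obtain ⟨x, hx, r, hr, hσ, hy'⟩ := ih' hm.1 hnd.1 hc'' h''
      refine ⟨x, by simp [letters, hx], r, hr, hσ, fun y => ?_⟩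
      simp [hy, hy', hy'', subst_update_of_notMem (hnd.2.2 hx)]
    · obtain ⟨x, hx, r, hr, hσ, hy'⟩ := ih hm.2 hnd.2.1 hc' h'
      refine ⟨x, by simp [letters, hx], r, hr, hσ, fun y => ?_⟩
      simp [hy, hy', subst_update_of_notMem (fun h => hnd.2.2 h hx)]

open Classical in
/-- Substituting words `r y` for a variable that occurs exactly once is a context in `y`. -/
theorem isContext_subst_update {m : OpWord Ω X} (hnd : m.letters.Nodup) {x : X}
    (hx : x ∈ m.letters) (σ : X → OpWord Ω Z) {r : OpWord Ω Z → OpWord Ω Z} (hr : IsContext r) :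
    IsContext fun y => subst (Function.update σ x (r y)) m := by
  induction m with
  | var z =>
    obtain rfl : x = z := by simpa [letters] using hx
    simpa using hr
  | op ω w ih => exact (ih hnd hx).op ω
  | varMul z w ih =>
    simp only [letters, List.nodup_cons, List.mem_cons] at hnd hx
    rcases hx with rfl | hx
    · convert hr.mul_right (subst σ w) using 2
      simp [subst_update_of_notMem hnd.1]
    · have : z ≠ x := by rintro rfl; exact hnd.1 hx
      convert (ih hnd.2 hx).mul_left (σ z) using 2
      simp [Function.update_of_ne this]
  | opMul ω u w ih' ih =>
    simp only [letters, List.nodup_append', List.mem_append] at hnd hx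
    rcases hx with hx | hx
    · convert ((ih' hnd.1 hx).op ω).mul_right (subst σ w) using 2
      simp [subst_update_of_notMem (hnd.2.2 hx)]
    · convert (ih hnd.2.1 hx).mul_left (OpWord.op ω (subst σ u)) using 2
      simp [subst_update_of_notMem (fun h => hnd.2.2 h hx)]

-- A word that does not start with a bracket starts with a variable. As that variable occurs only
-- once, prepending `v` to its value prepends `v` to the whole word and changes nothing else.
open Classical in
theorem startsOp_or_exists_update {m : OpWord Ω X} (hnd : m.letters.Nodup)
    (σ : X → OpWord Ω Z) : StartsOp (subst σ m) ∨ ∃ x, ∀ v,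
      subst (Function.update σ x (v * σ x)) m = v * subst σ m := by
  cases m with
  | var x => exact .inr ⟨x, by simp⟩
  | op ω w => exact .inl ⟨_, _, rfl⟩
  | varMul x w =>
    simp only [letters, List.nodup_cons] at hnd
    exact .inr ⟨x, by simp [subst_update_of_notMem hnd.1, mul_assoc]⟩
  | opMul ω u w => exact .inl ⟨_, _, rfl⟩

open Classical in
theorem endsOp_or_exists_update {m : OpWord Ω X} (hnd : m.letters.Nodup)
    (σ : X → OpWord Ω Z) : EndsOp (subst σ m) ∨ ∃ x ∈ m.letters, ∀ v,
      subst (Function.update σ x (σ x * v)) m = subst σ m * v := by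
  induction m with
  | var x => exact .inr ⟨x, by simp [letters]⟩
  | op ω w => exact .inl ⟨_, [], rfl⟩
  | varMul x w ih =>
    simp only [letters, List.nodup_cons] at hnd
    rcases ih hnd.2 with ⟨l, L, h⟩ | ⟨y, hy, h⟩
    · exact .inl ⟨l, toList (σ x) ++ L, by simp [h]⟩
    · have : x ≠ y := by rintro rfl; exact hnd.1 hy
      exact .inr ⟨y, by simp [letters, hy], by simp [h, Function.update_of_ne this, mul_assoc]⟩
  | opMul ω u w ih' ih =>
    simp only [letters, List.nodup_append'] at hnd
    rcases ih hnd.2.1 with ⟨l, L, h⟩ | ⟨y, hy, h⟩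
    · exact .inl ⟨l, Sum.inr (ω, subst σ u) :: L, by simp [h]⟩
    · exact .inr ⟨y, by simp [letters, hy],
        by simp [h, subst_update_of_notMem (fun h => hnd.2.2 h hy)]⟩

theorem isPure_ofWord (v : FreeSemigroup Z) : IsPure (ofWord v : OpWord Ω Z) := by
  induction v using FreeSemigroup.recOnMul with
  | ih1 z => simp [IsPure, ofWord_of]
  | ih2 z v h1 h2 =>
    intro l hl
    rw [ofWord_mul, toList_mul, List.mem_append] at hl
    exact hl.elim (h1 l) (h2 l)

theorem IsPure.exists_ofWord {w : OpWord Ω Z} (hw : IsPure w) : ∃ v, ofWord v = w := by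
  induction w with
  | var z => exact ⟨_, ofWord_of z⟩
  | op ω w => simp [IsPure] at hw
  | varMul z w ih =>
    obtain ⟨v, rfl⟩ := ih fun l hl => hw l (by simp [hl])
    exact ⟨FreeSemigroup.of z * v, ofWord_mul _ _⟩
  | opMul ω u w => simp [IsPure] at hw

theorem isPure_of_subst {m : OpWord Ω X} {σ : X → OpWord Ω Z} (h : IsPure (subst σ m)) :
    IsPure m := by
  induction m with
  | var x => simp [IsPure]
  | op ω w => simp [IsPure] at h
  | varMul x w ih =>
    have := ih fun l hl => h l (by simp [hl])
    intro l hl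
    rcases List.mem_cons.1 hl with rfl | hl
    · rfl
    · exact this l hl
  | opMul ω u w => simp [IsPure] at h

theorem breadth_ofWord (v : FreeSemigroup Z) :
    breadth (ofWord v : OpWord Ω Z) = FreeSemigroup.length v := by
  rw [breadth_eq_length]
  induction v using FreeSemigroup.recOnMul with
  | ih1 z => simp [ofWord_of]
  | ih2 z v h1 h2 => rw [ofWord_mul, toList_mul, List.length_append, h1, h2,
      FreeSemigroup.length_mul]

theorem ofWord_injective : Function.Injective (ofWord : FreeSemigroup Z → OpWord Ω Z) := by
  have h : ∀ v : FreeSemigroup Z, toList (ofWord v : OpWord Ω Z) =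
      (v.head :: v.tail).map Sum.inl := by
    intro v
    induction v using FreeSemigroup.recOnMul with
    | ih1 z => rfl
    | ih2 z v h1 h2 => rw [ofWord_mul, toList_mul, h1, h2]; simp
  intro u v huv
  have := congrArg toList huv
  rw [h, h] at this
  have := List.map_injective_iff.2 Sum.inl_injective this
  simp only [List.cons.injEq] at this
  exact FreeSemigroup.ext this.1 this.2

end Occurrences

end OpWord

namespace OpWord

/-! ### Relabelling letters, and why leading monomials cannot cancel. -/

section Relabelling

variable {Ω X Z : Type*}

/-- The word obtained by forgetting which elements of `Z` occur. -/
def shape (w : OpWord Ω Z) : OpWord Ω Unit := subst (fun _ => var ()) w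

theorem shape_mul (u v : OpWord Ω Z) : shape (u * v) = shape u * shape v := subst_mul _ _ _

theorem shape_subst (σ : X → OpWord Ω Z) (w : OpWord Ω X) :
    shape (subst σ w) = subst (fun x => shape (σ x)) w := subst_subst _ _ _

theorem exists_mul_of_shape_eq_mul {W : OpWord Ω Z} {A B : OpWord Ω Unit} (h : shape W = A * B) :
    ∃ W₁ W₂, W = W₁ * W₂ ∧ shape W₁ = A ∧ shape W₂ = B := by
  induction W generalizing A with
  | var z => cases A <;> simp [shape] at h
  | op ω w _ => cases A <;> simp [shape] at h
  | varMul z w ih =>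
    cases A with
    | var a => exact ⟨var z, w, rfl, rfl, by simpa [shape] using h⟩
    | varMul a A =>
      obtain ⟨W₁, W₂, rfl, h1, h2⟩ := ih (A := A) (by simpa [shape] using h)
      exact ⟨varMul z W₁, W₂, rfl, congrArg (varMul ()) h1, h2⟩
    | _ => simp [shape] at h
  | opMul ω t w _ ih =>
    cases A with
    | op ω' a =>
      simp only [shape, subst_opMul, op_mul, opMul.injEq] at h
      exact ⟨op ω t, w, rfl, by simp [shape, h], h.2.2⟩
    | opMul ω' a A =>
      simp only [shape, subst_opMul, opMul_mul, opMul.injEq] at h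
      obtain ⟨W₁, W₂, rfl, h1, h2⟩ := ih (A := A) h.2.2
      exact ⟨opMul ω t W₁, W₂, rfl, by simpa [shape, h] using h1, h2⟩
    | _ => simp [shape] at h

/-- Consecutive labels make all letters distinct, which later makes substitutions injective. -/
theorem exists_relabel (W : OpWord Ω Z) (n : ℕ) : ∃ W' : OpWord Ω ℕ,
    shape W' = shape W ∧ W'.letters = List.range' n W.letters.length := by
  induction W generalizing n with
  | var z => exact ⟨var n, rfl, rfl⟩
  | op ω w ih =>
    obtain ⟨w', h1, h2⟩ := ih n
    exact ⟨op ω w', congrArg (op ω) h1, h2⟩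
  | varMul z w ih =>
    obtain ⟨w', h1, h2⟩ := ih (n + 1)
    exact ⟨varMul n w', congrArg (varMul ()) h1, by simp [letters, h2, List.range'_succ]⟩
  | opMul ω t w ih' ih =>
    obtain ⟨t', h1, h2⟩ := ih' n
    obtain ⟨w', h3, h4⟩ := ih (n + t.letters.length)
    exact ⟨opMul ω t' w', congrArg₂ (opMul ω) h1 h3, by simp [letters, h2, h4]⟩

open Classical in
/-- A word with the shape of `m(σ)` is `m(ρ)` for some `ρ` with the shape of `σ`. -/
theorem exists_subst_of_shape_eq {Y : Type*} {m : OpWord Ω X} (hnd : m.letters.Nodup)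
    {σ : X → OpWord Ω Z} {W : OpWord Ω Y} (h : shape W = shape (subst σ m)) :
    ∃ ρ : X → OpWord Ω Y, subst ρ m = W ∧ ∀ x ∈ m.letters, shape (ρ x) = shape (σ x) := by
  induction m generalizing W with
  | var x => exact ⟨fun _ => W, rfl, by simpa [letters] using h⟩
  | op ω w ih =>
    cases W with
    | op ω' W =>
      simp only [shape, subst_op, op.injEq] at h
      obtain ⟨ρ, rfl, h2⟩ := ih hnd h.2
      exact ⟨ρ, by simp [h.1], h2⟩
    | _ => simp [shape] at h
  | varMul x w ih =>
    simp only [letters, List.nodup_cons] at hnd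
    obtain ⟨W₁, W₂, rfl, h1, h2⟩ := exists_mul_of_shape_eq_mul (h.trans (shape_mul _ _))
    obtain ⟨ρ, rfl, h4⟩ := ih hnd.2 h2
    refine ⟨Function.update ρ x W₁, by simp [subst_update_of_notMem hnd.1], fun y hy => ?_⟩
    by_cases hyx : y = x
    · subst hyx; simpa using h1
    · rw [Function.update_of_ne hyx]
      exact h4 y ((List.mem_cons.1 hy).resolve_left hyx)
  | opMul ω t w ih' ih =>
    simp only [letters, List.nodup_append'] at hnd
    obtain ⟨W₁, W₂, rfl, h1, h2⟩ := exists_mul_of_shape_eq_mul (A := op ω (shape (subst σ t))) h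
    cases W₁ with
    | op ω' W₁ =>
      simp only [shape, subst_op, op.injEq] at h1
      obtain ⟨ρ, rfl, h3⟩ := ih hnd.2.1 h2
      obtain ⟨ρ', rfl, h4⟩ := ih' hnd.1 h1.2
      refine ⟨fun x => if x ∈ t.letters then ρ' x else ρ x, ?_, fun x hx => ?_⟩
      · rw [subst_opMul, subst_congr (τ := ρ') (w := t) (by simp +contextual),
          subst_congr (τ := ρ) (w := w) fun x hx => if_neg fun h => hnd.2.2 h hx]
        simp [h1.1]
      · by_cases hxt : x ∈ t.letters
        · simpa [hxt] using h4 x hxt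
        · simpa [hxt] using h3 x ((List.mem_append.1 hx).resolve_left hxt)
    | _ => simp [shape] at h1

/-- A substitution whose values can be decoded from left to right is injective. -/
theorem subst_injOn {η : X → OpWord Ω Z} {V : Set X}
    (h₁ : ∀ x ∈ V, ∀ y ∈ V, x ≠ y → ∀ A B, toList (η x) ++ A ≠ toList (η y) ++ B)
    (h₂ : ∀ x ∈ V, ∀ w : OpWord Ω X, (∀ y ∈ w.letters, y ∈ V) → ∀ ω A B,
      toList (η x) ++ A ≠ Sum.inr (ω, subst η w) :: B) :
    Set.InjOn (subst η) {w | ∀ y ∈ w.letters, y ∈ V} := by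
  have h₁' : ∀ x ∈ V, ∀ y ∈ V, ∀ A B, toList (η x) ++ A = toList (η y) ++ B → x = y ∧ A = B := by
    intro x hx y hy A B h
    obtain rfl : x = y := by
      by_contra hxy
      exact h₁ x hx y hy hxy A B h
    exact ⟨rfl, List.append_cancel_left h⟩
  intro m hm m' hm' h
  replace h := congrArg toList h
  induction m generalizing m' with
  | var x =>
    have hx : x ∈ V := hm x (by simp [letters])
    cases m' with
    | var y => simp [(h₁' x hx y (hm' y (by simp [letters])) [] [] (by simpa using h)).1]
    | op ω w => exact (h₂ x hx w hm' ω [] [] (by simpa using h)).elim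
    | varMul y w =>
      have := h₁' x hx y (hm' y (by simp [letters])) [] (toList (subst η w)) (by simpa using h)
      simp at this
    | opMul ω u w =>
      exact (h₂ x hx u (fun y hy => hm' y (by simp [letters, hy])) ω [] _ (by simpa using h)).elim
  | op ω v ih =>
    cases m' with
    | var y =>
      exact (h₂ y (hm' y (by simp [letters])) v hm ω [] [] (by simpa using h.symm)).elim
    | op ω w =>
      simp only [subst_op, toList_op, List.cons.injEq, Sum.inr.injEq, Prod.mk.injEq] at h
      rw [ih (m' := w) hm hm' (by rw [h.1.2]), h.1.1]
    | varMul y w =>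
      exact (h₂ y (hm' y (by simp [letters])) v hm ω (toList (subst η w)) []
        (by simpa using h.symm)).elim
    | opMul ω u w => simp at h
  | varMul x v ih =>
    have hx : x ∈ V := hm x (by simp [letters])
    cases m' with
    | var y =>
      have := h₁' x hx y (hm' y (by simp [letters])) (toList (subst η v)) [] (by simpa using h)
      simp at this
    | op ω w => exact (h₂ x hx w hm' ω (toList (subst η v)) [] (by simpa using h)).elim
    | varMul y w =>
      have := h₁' x hx y (hm' y (by simp [letters])) (toList (subst η v)) (toList (subst η w))
        (by simpa using h)
      rw [this.1, ih (fun y hy => hm y (by simp [letters, hy]))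
        (fun y hy => hm' y (by simp [letters, hy])) this.2]
    | opMul ω u w =>
      exact (h₂ x hx u (fun y hy => hm' y (by simp [letters, hy])) ω (toList (subst η v))
        (toList (subst η w)) (by simpa using h)).elim
  | opMul ω t v ih' ih =>
    have ht : ∀ y ∈ t.letters, y ∈ V := fun y hy => hm y (by simp [letters, hy])
    cases m' with
    | var y =>
      exact (h₂ y (hm' y (by simp [letters])) t ht ω [] (toList (subst η v))
        (by simpa using h.symm)).elim
    | op ω w => simp at h
    | varMul y w =>
      exact (h₂ y (hm' y (by simp [letters])) t ht ω (toList (subst η w)) (toList (subst η v))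
        (by simpa using h.symm)).elim
    | opMul ω u w =>
      simp only [subst_opMul, toList_opMul, List.cons.injEq, Sum.inr.injEq, Prod.mk.injEq] at h
      rw [ih' (m' := u) ht (fun y hy => hm' y (by simp [letters, hy])) (by rw [h.1.2]), h.1.1,
        ih (m' := w) (fun y hy => hm y (by simp [letters, hy]))
          (fun y hy => hm' y (by simp [letters, hy])) h.2]

/-- The number of brackets of a word. -/
def opCount : OpWord Ω Z → ℕ
  | var _ => 0
  | op _ w => opCount w + 1
  | varMul _ w => opCount w
  | opMul _ u w => opCount u + 1 + opCount w

theorem opCount_mul (u v : OpWord Ω Z) : opCount (u * v) = opCount u + opCount v := by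
  induction u with
  | var z => simp [opCount]
  | op ω w _ => simp [opCount]
  | varMul z w ih => simp [opCount, ih]
  | opMul ω t w _ ih => simp [opCount, ih, add_assoc]

theorem opCount_le_opCount_subst (ρ : X → OpWord Ω Z) {w : OpWord Ω X} {x : X}
    (hx : x ∈ w.letters) : opCount (ρ x) ≤ opCount (subst ρ w) := by
  induction w with
  | var y =>
    obtain rfl : x = y := by simpa [letters] using hx
    rfl
  | op ω w ih => exact (ih hx).trans (Nat.le_succ _)
  | varMul y w ih =>
    simp only [letters, List.mem_cons] at hx
    rw [subst_varMul, opCount_mul]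
    rcases hx with rfl | hx
    · omega
    · have := ih hx
      omega
  | opMul ω t w ih' ih =>
    simp only [letters, List.mem_append] at hx
    rw [subst_opMul, opCount]
    rcases hx with hx | hx
    · have := ih' hx
      omega
    · have := ih hx
      omega

/-- Values at different variables have disjoint letters, so the first letter identifies the
variable. The remaining danger is that `ρ x` begins with a bracket ⌊w(ρ)⌋. Its first letter would
force x to occur in w, so `ρ x` would sit inside a bracket of itself, against the count of brackets.
-/
theorem subst_injOn_of_nodup {Y : Type*} {ρ : X → OpWord Ω Y} {L : List X}
    (h : (L.flatMap fun x => letters (ρ x)).Nodup) :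
    Set.InjOn (subst ρ) {w | ∀ y ∈ w.letters, y ∈ L} := by
  have hdisj : ∀ x ∈ L, ∀ y ∈ L, x ≠ y → List.Disjoint (letters (ρ x)) (letters (ρ y)) := by
    have : Std.Symm (Function.onFun List.Disjoint fun x => letters (ρ x)) :=
      ⟨fun _ _ hab => List.Disjoint.symm hab⟩
    intro x hx y hy hxy
    exact (List.nodup_flatMap.1 h).2.forall hx hy hxy
  refine subst_injOn (V := {x | x ∈ L}) (fun x hx y hy hxy A B hAB => ?_)
    fun x hx w hw ω A B hAB => ?_
  · have := congrArg (List.flatMap fun l => letters (ofLetter l)) hAB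
    simp only [List.flatMap_append, ← letters_eq_flatMap_toList] at this
    obtain ⟨a, La, ha⟩ := List.exists_cons_of_ne_nil (letters_ne_nil (ρ x))
    obtain ⟨b, Lb, hb⟩ := List.exists_cons_of_ne_nil (letters_ne_nil (ρ y))
    rw [ha, hb] at this
    simp only [List.cons_append, List.cons.injEq] at this
    exact hdisj x hx y hy hxy (a := a) (by simp [ha]) (by simp [hb, this.1])
  · have := congrArg (List.flatMap fun l => letters (ofLetter l)) hAB
    rw [List.flatMap_append, ← letters_eq_flatMap_toList, List.flatMap_cons,
      show letters (ofLetter (Sum.inr (ω, subst ρ w))) = letters (subst ρ w) from rfl] at this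
    obtain ⟨a, La, ha⟩ := List.exists_cons_of_ne_nil (letters_ne_nil (ρ x))
    obtain ⟨b, Lb, hb⟩ := List.exists_cons_of_ne_nil (letters_ne_nil (subst ρ w))
    rw [ha, hb] at this
    simp only [List.cons_append, List.cons.injEq] at this
    obtain ⟨y, hy, hby⟩ : ∃ y ∈ w.letters, b ∈ (ρ y).letters := by
      rw [← List.mem_flatMap, ← letters_subst, hb]
      simp
    obtain rfl : x = y := by
      by_contra hxy
      exact hdisj x hx y (hw y hy) hxy (a := a) (by simp [ha]) (this.1 ▸ hby)
    have hle := opCount_le_opCount_subst ρ hy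
    cases hρ : ρ x with
    | op ω' v =>
      simp only [hρ, toList_op, List.cons_append, List.cons.injEq, Sum.inr.injEq,
        Prod.mk.injEq] at hAB
      rw [hρ, opCount, hAB.1.2] at hle
      omega
    | opMul ω' v v' =>
      simp only [hρ, toList_opMul, List.cons_append, List.cons.injEq, Sum.inr.injEq,
        Prod.mk.injEq] at hAB
      rw [hρ, opCount, hAB.1.2] at hle
      omega
    | _ => simp [hρ] at hAB

/-- The words `zⁿ⁺¹ ⌊z⌋_ω`, which code the natural numbers. -/
def code (ω : Ω) (z : Z) : ℕ → OpWord Ω Z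
  | 0 => varMul z (op ω (var z))
  | n + 1 => varMul z (code ω z n)

/-- The bracket marks the end of the run of `z`, so no code is a prefix of another; each code starts
with `z`, so it is never confused with a bracket. -/
theorem subst_code_injective (ω : Ω) (z : Z) : Function.Injective (subst (code ω z)) := by
  have h : Set.InjOn (subst (code ω z)) {w | ∀ y ∈ w.letters, y ∈ Set.univ} := by
    refine subst_injOn (fun x _ y _ hxy A B => ?_) fun x _ w _ ω A B => ?_
    · clear * - hxy
      induction x generalizing y with
      | zero =>
        cases y with
        | zero => exact (hxy rfl).elim
        | succ y => cases y <;> simp [code]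
      | succ x ih =>
        cases y with
        | zero => cases x <;> simp [code]
        | succ y => simpa [code] using ih y (by simpa using hxy)
    · cases x <;> simp [code]
  intro u v huv
  exact h (by simp) (by simp) huv

/-- If `m'(σ) < m(σ)` whenever the substitution `σ` is injective on a set of multilinear words that
contains `m` and `m'`, then `m'(σ) ≠ m(σ)` for all `σ`. -/
theorem subst_ne_subst [Nonempty Ω] {lt : OpWord Ω Z → OpWord Ω Z → Prop} (hlt : WellFounded lt)
    {S : Set (OpWord Ω X)} {V : Finset X} (hS : ∀ m ∈ S, (m.letters : Multiset X) = V.val)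
    {m m' : OpWord Ω X} (hm : m ∈ S) (hm' : m' ∈ S)
    (h : ∀ σ, Set.InjOn (subst σ) S → lt (subst σ m') (subst σ m)) (σ : X → OpWord Ω Z) :
    subst σ m' ≠ subst σ m := by
  intro heq
  obtain ⟨ω⟩ := ‹Nonempty Ω›
  obtain ⟨z, -⟩ := List.exists_mem_of_ne_nil _ (letters_ne_nil (subst σ m))
  have hnd : ∀ m ∈ S, m.letters.Nodup := fun m hm => by
    rw [← Multiset.coe_nodup, hS m hm]
    exact V.nodup
  have hmem : ∀ m₁ ∈ S, ∀ y ∈ m₁.letters, y ∈ m.letters := fun m₁ h₁ y hy => by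
    rw [← Multiset.mem_coe, hS m hm, ← hS m₁ h₁]
    exact hy
  -- All relabellings of `σ` that give the letters of `m` distinct labels. They are compared through
  -- the codes because the order lives on words over `Z`, which may have a single element.
  let T : Set (X → OpWord Ω ℕ) :=
    {ρ | (∀ x ∈ m.letters, shape (ρ x) = shape (σ x)) ∧ (subst ρ m).letters.Nodup}
  have hT : T.Nonempty := by
    obtain ⟨W, h1, h2⟩ := exists_relabel (subst σ m) 0
    obtain ⟨ρ, rfl, h3⟩ := exists_subst_of_shape_eq (hnd m hm) h1
    exact ⟨ρ, h3, by rw [h2]; exact List.nodup_range'⟩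
  have hwf := InvImage.wf (fun ρ : X → OpWord Ω ℕ => subst (code ω z) (subst ρ m)) hlt
  obtain ⟨ρ, ⟨hρ, hρnd⟩, hmin⟩ := hwf.has_min T hT
  have hshape : shape (subst ρ m') = shape (subst σ m) := by
    rw [← heq, shape_subst, shape_subst]
    exact subst_congr fun x hx => hρ x (hmem m' hm' x hx)
  have hnd' : (subst ρ m').letters.Nodup := by
    have hp : m'.letters.Perm m.letters := by
      rw [← Multiset.coe_eq_coe, hS m hm, hS m' hm']
    rw [letters_subst] at hρnd ⊢
    exact (hp.flatMap_right _).nodup_iff.2 hρnd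
  -- If `m` and `m'` agree at `σ`, then m'(ρ) has the shape of m(σ), hence is m(ρ') for another
  -- relabelling. But m'(ρ) is smaller than m(ρ) after coding, which contradicts the minimality of
  -- `ρ`.
  obtain ⟨ρ', h1, h2⟩ := exists_subst_of_shape_eq (hnd m hm) hshape
  refine hmin ρ' ⟨h2, h1 ▸ hnd'⟩ ?_
  change lt (subst (code ω z) (subst ρ' m)) (subst (code ω z) (subst ρ m))
  rw [h1, subst_subst, subst_subst]
  refine h _ fun m₁ h₁ m₂ h₂ h₁₂ => ?_
  rw [← subst_subst, ← subst_subst] at h₁₂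
  rw [letters_subst] at hρnd
  exact subst_injOn_of_nodup hρnd (hmem m₁ h₁) (hmem m₂ h₂)
    (subst_code_injective ω z h₁₂)

theorem eq_var_of_isEmpty [IsEmpty Ω] {m : OpWord Ω X} (hm : NoAdj m) : ∃ x, m = var x := by
  cases m with
  | var x => exact ⟨x, rfl⟩
  | varMul x w =>
    obtain ⟨⟨l, L, h⟩, -⟩ := hm
    exact isEmptyElim l.1
  | op ω w => exact isEmptyElim ω
  | opMul ω u w => exact isEmptyElim ω

theorem eq_var_of_letters_eq [IsEmpty Ω] {m : OpWord Ω X} {x : X} (hm : m.letters = [x]) :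
    m = var x := by
  cases m with
  | var y => simpa [letters] using hm
  | varMul y w => simp [letters, letters_ne_nil] at hm
  | op ω w => exact isEmptyElim ω
  | opMul ω u w => exact isEmptyElim ω

end Relabelling

end OpWord

open MonoidAlgebra

/-! ### Bilinear extension of maps on monomials. -/

section Bilinear

variable {k M N P : Type*} [Field k]

/-- The bilinear extension of a map `F : M → N → P`. -/
noncomputable def bilinMap (F : M → N → P) (f : MonoidAlgebra k M) (g : MonoidAlgebra k N) :
    MonoidAlgebra k P :=
  f.coeff.sum fun x c => c • mapDomain (F x) g

theorem mapDomain_eq_sum (F : N → P) (g : MonoidAlgebra k N) :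
    mapDomain F g = g.coeff.sum fun y d => single (F y) d := by
  conv_lhs => rw [← sum_coeff_single g, mapDomain_sum]
  simp

theorem bilinMap_comm (F : M → N → P) (f : MonoidAlgebra k M) (g : MonoidAlgebra k N) :
    bilinMap F f g = bilinMap (fun y x => F x y) g f := by
  simp only [bilinMap, mapDomain_eq_sum, Finsupp.smul_sum, smul_single, smul_eq_mul]
  rw [Finsupp.sum_comm]
  simp only [mul_comm]

theorem bilinMap_single_left (F : M → N → P) (x : M) (g : MonoidAlgebra k N) :
    bilinMap F (single x 1) g = mapDomain (F x) g := by
  simp [bilinMap]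

theorem bilinMap_sub_left (F : M → N → P) (f f' : MonoidAlgebra k M) (g : MonoidAlgebra k N) :
    bilinMap F (f - f') g = bilinMap F f g - bilinMap F f' g := by
  simp only [bilinMap, coeff_sub]
  exact Finsupp.sum_sub_index fun _ _ _ => sub_smul _ _ _

theorem bilinMap_mem (F : M → N → P) {f : MonoidAlgebra k M} {g : MonoidAlgebra k N}
    {U : Submodule k (MonoidAlgebra k P)} (h : ∀ x ∈ f.coeff.support, mapDomain (F x) g ∈ U) :
    bilinMap F f g ∈ U :=
  U.sum_mem fun x hx => U.smul_mem _ (h x hx)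

theorem mapDomain_sub (F : M → N) (f g : MonoidAlgebra k M) :
    mapDomain F (f - g) = mapDomain F f - mapDomain F g :=
  map_sub (mapDomainLinearMap k k F) f g

theorem mapDomain_comp_apply (F : N → P) (F' : M → N) (f : MonoidAlgebra k M) :
    mapDomain F (mapDomain F' f) = mapDomain (F ∘ F') f := by
  simp [mapDomain, Finsupp.mapDomain_comp]

theorem mapDomain_id_apply (f : MonoidAlgebra k M) : mapDomain id f = f := by
  ext; simp

end Bilinear

/-! ### Leading monomials and monic elements. -/

section LeadingMonomials

variable {k S : Type*} [Field k] {lt : S → S → Prop}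

variable (k) in
/-- The linear combinations of monomials smaller than `p`. -/
noncomputable def lowerSub (lt : S → S → Prop) (p : S) : Submodule k (MonoidAlgebra k S) :=
  supported k k {m | lt m p}

theorem coeff_eq_zero_of_mem_lowerSub {f : MonoidAlgebra k S} {p m : S} (hf : f ∈ lowerSub k lt p)
    (hm : ¬ lt m p) : f.coeff m = 0 := by
  by_contra h
  exact hm (hf (Finsupp.mem_support_iff.2 h))

theorem mapDomain_mem_lowerSub {T : Type*} {lt' : T → T → Prop} {c : S → T} {p : S}
    (hc : ∀ u, lt u p → lt' (c u) (c p)) {f : MonoidAlgebra k S} (hf : f ∈ lowerSub k lt p) :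
    mapDomain c f ∈ lowerSub k lt' (c p) := by
  classical
  intro m hm
  obtain ⟨u, hu, rfl⟩ := Finset.mem_image.1 (Finsupp.mapDomain_support hm)
  exact hc u (hf hu)

/-- `f` is monic with leading monomial `m`. -/
def IsMonicAt (lt : S → S → Prop) (f : MonoidAlgebra k S) (m : S) : Prop :=
  f - single m 1 ∈ lowerSub k lt m

theorem IsLeadingMonomial.coeff_ne_zero {f : MonoidAlgebra k S} {m : S}
    (h : IsLeadingMonomial lt f m) : f.coeff m ≠ 0 := Finsupp.mem_support_iff.1 h.1

theorem IsLeadingMonomial.smul_inv_smul {s : MonoidAlgebra k S} {m : S}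
    (h : IsLeadingMonomial lt s m) : s.coeff m • (s.coeff m)⁻¹ • s = s := by
  rw [smul_smul, mul_inv_cancel₀ h.coeff_ne_zero, one_smul]

theorem IsLeadingMonomial.isMonicAt {f : MonoidAlgebra k S} {m : S}
    (h : IsLeadingMonomial lt f m) : IsMonicAt lt ((f.coeff m)⁻¹ • f) m := by
  intro u hu
  have hu := Finsupp.mem_support_iff.1 hu
  have hne : u ≠ m := by
    rintro rfl
    simp [h.coeff_ne_zero] at hu
  refine h.2 u (Finsupp.mem_support_iff.2 fun h0 => hu ?_) hne
  simp [h0, hne.symm]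

theorem IsMonicAt.mapDomain {T : Type*} {lt' : T → T → Prop} {f : MonoidAlgebra k S} {m : S}
    (h : IsMonicAt lt f m) {c : S → T} (hc : ∀ u, lt u m → lt' (c u) (c m)) :
    IsMonicAt lt' (mapDomain c f) (c m) := by
  have := mapDomain_mem_lowerSub hc h
  rwa [mapDomain_sub, mapDomain_single] at this

theorem IsMonicAt.sub_mem {f g : MonoidAlgebra k S} {m : S} (hf : IsMonicAt lt f m)
    (hg : IsMonicAt lt g m) : f - g ∈ lowerSub k lt m := by
  simpa using (lowerSub k lt m).sub_mem hf hg

theorem IsMonicAt.coeff_eq_one [Std.Irrefl lt] {f : MonoidAlgebra k S} {m : S}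
    (h : IsMonicAt lt f m) : f.coeff m = 1 := by
  have := coeff_eq_zero_of_mem_lowerSub h (irrefl (r := lt) m)
  simpa [sub_eq_zero] using this

theorem IsLeadingMonomial.unique [IsStrictTotalOrder S lt] {f : MonoidAlgebra k S} {m m' : S}
    (h : IsLeadingMonomial lt f m) (h' : IsLeadingMonomial lt f m') : m = m' := by
  by_contra hne
  exact asymm (r := lt) (h.2 m' h'.1 (Ne.symm hne)) (h'.2 m h.1 hne)

theorem exists_isLeadingMonomial [IsStrictTotalOrder S lt] {f : MonoidAlgebra k S} (hf : f ≠ 0) :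
    ∃ m, IsLeadingMonomial lt f m := by
  classical
  have hs : f.coeff.support.Nonempty := Finsupp.support_nonempty_iff.2 (by simpa using hf)
  let := linearOrderOfSTO lt
  exact ⟨f.coeff.support.max' hs, Finset.max'_mem _ _, fun m' hm' hne =>
    lt_of_le_of_ne (Finset.le_max' _ _ hm') hne⟩

theorem IsLeadingMonomial.mapDomain_of_injective {T : Type*} {lt' : T → T → Prop} {c : S → T}
    (hinj : Function.Injective c) (hc : ∀ u v, lt u v ↔ lt' (c u) (c v)) {f : MonoidAlgebra k S}
    {m : S} : IsLeadingMonomial lt' (mapDomain c f) (c m) ↔ IsLeadingMonomial lt f m := by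
  classical
  have hsupp : (mapDomain c f).coeff.support = f.coeff.support.image c :=
    Finsupp.mapDomain_support_of_injective hinj _
  simp only [IsLeadingMonomial, hsupp, Finset.mem_image, hinj.eq_iff, exists_eq_right,
    forall_exists_index, and_imp, forall_apply_eq_imp_iff₂, hc, ne_eq]

end LeadingMonomials

/-! ### The span of `q|_s` -/

section LevelSpan

variable {k S : Type*} [Field k] {lt : S → S → Prop} {ctx : Set (S → S)}
  {G G' : Set (MonoidAlgebra k S)}

/-- The span of the `q|_s` with `s ∈ G` for which `q|_{s̄}` has the property `P`. -/
noncomputable def levelSpan (ctx : Set (S → S)) (lt : S → S → Prop) (G : Set (MonoidAlgebra k S))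
    (P : S → Prop) : Submodule k (MonoidAlgebra k S) :=
  Submodule.span k {x | ∃ q ∈ ctx, ∃ s ∈ G, ∃ m, IsLeadingMonomial lt s m ∧ P (q m) ∧
    x = mapDomain q s}

theorem isTrivialMod_iff [Semigroup S] {p : S} {h : MonoidAlgebra k S} :
    IsTrivialMod ctx lt G p h ↔ h ∈ levelSpan ctx lt G (lt · p) := Iff.rfl

theorem levelSpan_mono {P P' : S → Prop} (hG : G ⊆ G') (hP : ∀ u, P u → P' u) :
    levelSpan ctx lt G P ≤ levelSpan ctx lt G' P' := by
  refine Submodule.span_mono ?_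
  rintro _ ⟨q, hq, s, hs, m, hm, hp, rfl⟩
  exact ⟨q, hq, s, hG hs, m, hm, hP _ hp, rfl⟩

theorem mapDomain_mem_levelSpan_of {T : Type*} {lt' : T → T → Prop} {ctx' : Set (T → T)}
    {c : S → T} {H : Set (MonoidAlgebra k T)} {P : S → Prop} {P' : T → Prop}
    (h : ∀ q ∈ ctx, ∀ s ∈ G, ∀ m, IsLeadingMonomial lt s m → P (q m) →
      mapDomain c (mapDomain q s) ∈ levelSpan ctx' lt' H P')
    {f : MonoidAlgebra k S} (hf : f ∈ levelSpan ctx lt G P) :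
    mapDomain c f ∈ levelSpan ctx' lt' H P' := by
  have : levelSpan ctx lt G P ≤ (levelSpan ctx' lt' H P').comap (mapDomainLinearMap k k c) := by
    refine Submodule.span_le.2 ?_
    rintro _ ⟨q, hq, s, hs, m, hm, hp, rfl⟩
    exact h q hq s hs m hm hp
  exact this hf

theorem mapDomain_mem_levelSpan {c : S → S} (hcomp : ∀ q ∈ ctx, c ∘ q ∈ ctx) {P P' : S → Prop}
    (hP : ∀ u, P u → P' (c u)) {f : MonoidAlgebra k S} (hf : f ∈ levelSpan ctx lt G P) :
    mapDomain c f ∈ levelSpan ctx lt G P' := by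
  refine mapDomain_mem_levelSpan_of (fun q hq s hs m hm hp => Submodule.subset_span ?_) hf
  exact ⟨c ∘ q, hcomp q hq, s, hs, m, hm, hP _ hp, mapDomain_comp_apply _ _ _⟩

theorem smul_mapDomain_mem_levelSpan {P : S → Prop} {q : S → S} (hq : q ∈ ctx)
    {s : MonoidAlgebra k S} (hs : s ∈ G) {m : S} (hm : IsLeadingMonomial lt s m) (hp : P (q m))
    (a : k) : mapDomain q (a • s) ∈ levelSpan ctx lt G P := by
  rw [mapDomain_smul]
  exact Submodule.smul_mem _ _ (Submodule.subset_span ⟨q, hq, s, hs, m, hm, hp, rfl⟩)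

/-- With f and g the monic multiples, F(f, b₂) − F(b₁, g) = F(f − b₁, g) − F(f, g − b₂). The first
summand expands into contexts of g, the second into contexts of f, all at levels below F(b₁, b₂). -/
theorem bilinMap_mem_levelSpan_of_disjoint {F : S → S → S} (hF₁ : ∀ y, (F · y) ∈ ctx)
    (hF₂ : ∀ x, F x ∈ ctx) (hmono : ∀ q ∈ ctx, ∀ u v, lt u v → lt (q u) (q v))
    {s₁ s₂ : MonoidAlgebra k S} (hs₁ : s₁ ∈ G) (hs₂ : s₂ ∈ G) {b₁ b₂ : S}
    (hb₁ : IsLeadingMonomial lt s₁ b₁) (hb₂ : IsLeadingMonomial lt s₂ b₂) :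
    mapDomain (F · b₂) ((s₁.coeff b₁)⁻¹ • s₁) - mapDomain (F b₁) ((s₂.coeff b₂)⁻¹ • s₂) ∈
      levelSpan ctx lt G (lt · (F b₁ b₂)) := by
  set f := (s₁.coeff b₁)⁻¹ • s₁
  set g := (s₂.coeff b₂)⁻¹ • s₂
  have hF₁' : ∀ x, lt x b₁ → lt (F x b₂) (F b₁ b₂) := fun x => hmono _ (hF₁ b₂) x b₁
  have hF₂' : ∀ y, lt y b₂ → lt (F b₁ y) (F b₁ b₂) := fun y => hmono _ (hF₂ b₁) y b₂
  have h1 : bilinMap F (f - single b₁ 1) g ∈ levelSpan ctx lt G (lt · (F b₁ b₂)) :=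
    bilinMap_mem _ fun x hx => smul_mapDomain_mem_levelSpan (P := (lt · (F b₁ b₂))) (hF₂ x) hs₂ hb₂
      (hF₁' x (hb₁.isMonicAt hx)) _
  have h2 : bilinMap (fun y x => F x y) (g - single b₂ 1) f ∈
      levelSpan ctx lt G (lt · (F b₁ b₂)) :=
    bilinMap_mem _ fun y hy => smul_mapDomain_mem_levelSpan (P := (lt · (F b₁ b₂))) (hF₁ y) hs₁ hb₁
      (hF₂' y (hb₂.isMonicAt hy)) _
  rw [bilinMap_sub_left, bilinMap_single_left] at h1 h2
  rw [bilinMap_comm (fun y x => F x y)] at h2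
  convert Submodule.sub_mem _ h1 h2 using 1
  abel

variable [IsStrictTotalOrder S lt]

theorem levelSpan_le_lowerSub (hmono : ∀ q ∈ ctx, ∀ u v, lt u v → lt (q u) (q v)) (p : S) :
    levelSpan ctx lt G (lt · p) ≤ lowerSub k lt p := by
  classical
  refine Submodule.span_le.2 ?_
  rintro _ ⟨q, hq, s, hs, m, hm, hp, rfl⟩ u hu
  obtain ⟨v, hv, rfl⟩ := Finset.mem_image.1 (Finsupp.mapDomain_support hu)
  by_cases hvm : v = m
  · exact hvm ▸ hp
  · exact _root_.trans (r := lt) (hmono q hq _ _ (hm.2 v hv hvm)) hp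

/-- A finite sum has a largest level; it starts, and restarts, the descent in the
Composition-Diamond lemma. -/
theorem exists_mem_levelSpan_le {P : S → Prop} {f : MonoidAlgebra k S}
    (hf : f ∈ levelSpan ctx lt G P) :
    f = 0 ∨ ∃ w, P w ∧ f ∈ levelSpan ctx lt G fun u => ¬ lt w u := by
  induction hf using Submodule.span_induction with
  | mem x hx =>
    obtain ⟨q, hq, s, hs, m, hm, hp, rfl⟩ := hx
    exact .inr ⟨q m, hp, Submodule.subset_span ⟨q, hq, s, hs, m, hm, irrefl _, rfl⟩⟩
  | zero => exact .inl rfl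
  | smul a x _ ih =>
    rcases ih with rfl | ⟨w, hw, h⟩
    · simp
    · exact .inr ⟨w, hw, Submodule.smul_mem _ _ h⟩
  | add x y _ _ ihx ihy =>
    rcases ihx with rfl | ⟨w, hw, h⟩
    · simpa using ihy
    rcases ihy with rfl | ⟨w', hw', h'⟩
    · exact .inr ⟨w, hw, by simpa using h⟩
    have key : ∀ w w', lt w w' → levelSpan ctx lt G (fun u => ¬ lt w u) ≤
        levelSpan ctx lt G (fun u => ¬ lt w' u) := fun w w' hww' =>
      levelSpan_mono subset_rfl fun u hu h => hu (_root_.trans hww' h)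
    rcases trichotomous_of lt w w' with hww' | rfl | hww'
    · exact .inr ⟨w', hw', Submodule.add_mem _ (key _ _ hww' h) h'⟩
    · exact .inr ⟨w, hw, Submodule.add_mem _ h h'⟩
    · exact .inr ⟨w, hw, Submodule.add_mem _ h (key _ _ hww' h')⟩

/-- Any two `q|_s` (`s` monic) with the same leading monomial agree modulo smaller ones. -/
def IsResolved (ctx : Set (S → S)) (lt : S → S → Prop) (G : Set (MonoidAlgebra k S)) : Prop :=
  ∀ c₁ ∈ ctx, ∀ c₂ ∈ ctx, ∀ s₁ ∈ G, ∀ s₂ ∈ G, ∀ b₁ b₂, IsLeadingMonomial lt s₁ b₁ →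
    IsLeadingMonomial lt s₂ b₂ → c₁ b₁ = c₂ b₂ →
    mapDomain c₁ ((s₁.coeff b₁)⁻¹ • s₁) - mapDomain c₂ ((s₂.coeff b₂)⁻¹ • s₂) ∈
      levelSpan ctx lt G (lt · (c₁ b₁))

/-- All generators at level `w` agree, up to scalars and lower levels, with one fixed generator `e`.
Modulo lower levels `f` is then the multiple of `e` given by its coefficient at `w`, which vanishes.
-/
theorem IsResolved.mem_levelSpan_lt (hG : IsResolved ctx lt G)
    (hmono : ∀ q ∈ ctx, ∀ u v, lt u v → lt (q u) (q v)) {w : S} {f : MonoidAlgebra k S}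
    (hf : f ∈ levelSpan ctx lt G fun u => ¬ lt w u) (hfw : f.coeff w = 0) :
    f ∈ levelSpan ctx lt G (lt · w) := by
  by_cases hw : ∃ q ∈ ctx, ∃ s ∈ G, ∃ m, IsLeadingMonomial lt s m ∧ q m = w
  · obtain ⟨q₀, hq₀, s₀, hs₀, m₀, hm₀, rfl⟩ := hw
    set e := mapDomain q₀ ((s₀.coeff m₀)⁻¹ • s₀)
    -- This form is linear in `f`, so it survives span induction; the vanishing of the coefficient
    -- does not.
    suffices h : f - f.coeff (q₀ m₀) • e ∈ levelSpan ctx lt G (lt · (q₀ m₀)) by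
      simpa [hfw] using h
    clear hfw
    induction hf using Submodule.span_induction with
    | mem x hx =>
      obtain ⟨q, hq, s, hs, m, hm, hp, rfl⟩ := hx
      rcases trichotomous_of lt (q m) (q₀ m₀) with hlt | heq | hlt
      · have hmem : mapDomain q s ∈ levelSpan ctx lt G (lt · (q₀ m₀)) :=
          Submodule.subset_span ⟨q, hq, s, hs, m, hm, hlt, rfl⟩
        rw [coeff_eq_zero_of_mem_lowerSub (levelSpan_le_lowerSub hmono _ hmem) (irrefl _)]
        simpa using hmem
      · have h1 := hG q hq q₀ hq₀ s hs s₀ hs₀ m m₀ hm hm₀ heq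
        have h2 := (hm.isMonicAt.mapDomain (hmono q hq · m)).coeff_eq_one
        rw [mapDomain_smul, coeff_smul_apply, smul_eq_mul, heq] at h2
        have h3 : (mapDomain q s).coeff (q₀ m₀) = s.coeff m := by
          rw [inv_mul_eq_one₀ hm.coeff_ne_zero] at h2
          exact h2.symm
        rw [h3, ← heq]
        convert Submodule.smul_mem _ (s.coeff m) h1 using 1
        rw [smul_sub, ← mapDomain_smul (x := (s.coeff m)⁻¹ • s), hm.smul_inv_smul]
      · exact (hp hlt).elim
    | zero => simp
    | smul a x _ ih =>
      convert Submodule.smul_mem _ a ih using 1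
      simp [smul_sub, smul_smul]
    | add x y _ _ ihx ihy =>
      convert Submodule.add_mem _ ihx ihy using 1
      simp only [coeff_add, Finsupp.add_apply, add_smul]
      abel
  · refine Submodule.span_mono ?_ hf
    rintro _ ⟨q, hq, s, hs, m, hm, hp, rfl⟩
    refine ⟨q, hq, s, hs, m, hm, ?_, rfl⟩
    rcases trichotomous_of lt (q m) w with h | h | h
    · exact h
    · exact (hw ⟨q, hq, s, hs, m, hm, h⟩).elim
    · exact (hp h).elim

/-- The Composition-Diamond lemma: an element of the span of the `q|_s` all of whose monomials are
smaller than `p` is trivial modulo `(G, p)`. -/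
theorem IsResolved.mem_levelSpan (hG : IsResolved ctx lt G) (hwf : WellFounded lt)
    (hmono : ∀ q ∈ ctx, ∀ u v, lt u v → lt (q u) (q v)) {P : S → Prop} {p : S}
    {f : MonoidAlgebra k S} (hf : f ∈ levelSpan ctx lt G P) (hfp : f ∈ lowerSub k lt p) :
    f ∈ levelSpan ctx lt G (lt · p) := by
  -- Descent on a bound `w` for the levels: while `w` is not below `p`, the coefficient of `f` at
  -- `w` is zero and the bound can be lowered.
  have key : ∀ w, f ∈ levelSpan ctx lt G (fun u => ¬ lt w u) →
      f ∈ levelSpan ctx lt G (lt · p) := by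
    intro w
    induction w using hwf.induction with
    | _ w ih =>
      intro hw
      by_cases hwp : lt w p
      · refine levelSpan_mono subset_rfl (fun u hu => ?_) hw
        rcases trichotomous_of lt u w with h | rfl | h
        · exact _root_.trans h hwp
        · exact hwp
        · exact (hu h).elim
      · have := hG.mem_levelSpan_lt hmono hw (coeff_eq_zero_of_mem_lowerSub hfp hwp)
        rcases exists_mem_levelSpan_le this with rfl | ⟨w', hw', h⟩
        · exact Submodule.zero_mem _
        · exact ih w' hw' h
  rcases exists_mem_levelSpan_le hf with rfl | ⟨w, -, h⟩
  · exact Submodule.zero_mem _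
  · exact key w h

end LevelSpan

/-! ### Compositions in terms of contexts. -/

section MonomialOrders

variable {k Ω Z : Type*} [Field k] {lt : OpWord Ω Z → OpWord Ω Z → Prop}
  {G : Set (MonoidAlgebra k (OpWord Ω Z))}

theorem IsMonomialOrder.lt_of_mem_opContexts (hlt : IsMonomialOrder lt) :
    ∀ q ∈ opContexts Ω Z, ∀ u v, lt u v → lt (q u) (q v) := by
  rintro _ ⟨q, hq, rfl⟩ u v huv
  exact hlt.plug_lt u v huv q hq

theorem comp_mem_opContexts {c : OpWord Ω Z → OpWord Ω Z} (hc : c ∈ opContexts Ω Z) :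
    ∀ q ∈ opContexts Ω Z, c ∘ q ∈ opContexts Ω Z := fun q hq => by
  rw [OpWord.mem_opContexts] at *
  exact hc.comp hq

theorem mapDomain_mem_levelSpan_opContexts (hlt : IsMonomialOrder lt)
    {c : OpWord Ω Z → OpWord Ω Z} (hc : c ∈ opContexts Ω Z) {p : OpWord Ω Z}
    {f : MonoidAlgebra k (OpWord Ω Z)} (hf : f ∈ levelSpan (opContexts Ω Z) lt G (lt · p)) :
    mapDomain c f ∈ levelSpan (opContexts Ω Z) lt G (lt · (c p)) :=
  mapDomain_mem_levelSpan (comp_mem_opContexts hc)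
    (fun u hu => hlt.lt_of_mem_opContexts c hc u p hu) hf

theorem mul_single_one {S : Type*} [Semigroup S] (f : MonoidAlgebra k S) (u : S) :
    f * single u 1 = mapDomain (· * u) f := by
  rw [mapDomain_eq_sum, mul_def]
  refine Finsupp.sum_congr fun x _ => ?_
  simp

theorem single_one_mul {S : Type*} [Semigroup S] (f : MonoidAlgebra k S) (u : S) :
    single u 1 * f = mapDomain (u * ·) f := by
  rw [mapDomain_eq_sum, mul_def]
  simp

/-- The `q|_s` given by two contexts and monic multiples of two polynomials agree modulo smaller
terms. -/
def Agree (lt : OpWord Ω Z → OpWord Ω Z → Prop) (G : Set (MonoidAlgebra k (OpWord Ω Z)))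
    (s₁ s₂ : MonoidAlgebra k (OpWord Ω Z)) (b₁ b₂ : OpWord Ω Z)
    (c₁ c₂ : OpWord Ω Z → OpWord Ω Z) : Prop :=
  mapDomain c₁ ((s₁.coeff b₁)⁻¹ • s₁) - mapDomain c₂ ((s₂.coeff b₂)⁻¹ • s₂) ∈
    levelSpan (opContexts Ω Z) lt G (lt · (c₁ b₁))

theorem Agree.symm {s₁ s₂ : MonoidAlgebra k (OpWord Ω Z)} {b₁ b₂ : OpWord Ω Z}
    {c₁ c₂ : OpWord Ω Z → OpWord Ω Z} (h : Agree lt G s₁ s₂ b₁ b₂ c₁ c₂) (heq : c₁ b₁ = c₂ b₂) :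
    Agree lt G s₂ s₁ b₂ b₁ c₂ c₁ := by
  have := Submodule.neg_mem _ h
  rwa [neg_sub, heq] at this

theorem Agree.comp (hlt : IsMonomialOrder lt) {s₁ s₂ : MonoidAlgebra k (OpWord Ω Z)}
    {b₁ b₂ : OpWord Ω Z} {c₁ c₂ d : OpWord Ω Z → OpWord Ω Z} (h : Agree lt G s₁ s₂ b₁ b₂ c₁ c₂)
    (hd : OpWord.IsContext d) : Agree lt G s₁ s₂ b₁ b₂ (d ∘ c₁) (d ∘ c₂) := by
  have := mapDomain_mem_levelSpan_opContexts hlt (OpWord.mem_opContexts.2 hd) h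
  rwa [mapDomain_sub, mapDomain_comp_apply, mapDomain_comp_apply] at this

theorem IsOmegaGSBasis.agree_inclusion (hG : IsOmegaGSBasis lt G)
    {s₁ s₂ : MonoidAlgebra k (OpWord Ω Z)} (hs₁ : s₁ ∈ G) (hs₂ : s₂ ∈ G) {b₁ b₂ : OpWord Ω Z}
    (hb₁ : IsLeadingMonomial lt s₁ b₁) (hb₂ : IsLeadingMonomial lt s₂ b₂)
    {q : OpWord Ω Z → OpWord Ω Z} (hq : OpWord.IsContext q) (h : b₁ = q b₂) :
    Agree lt G s₁ s₂ b₁ b₂ id q := by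
  have := (hG s₁ hs₁ s₂ hs₂ b₁ b₂ hb₁ hb₂ _ _ rfl rfl).2 q (OpWord.mem_opContexts.2 hq) b₁ rfl h
  rw [isTrivialMod_iff] at this
  rwa [Agree, mapDomain_id_apply]

theorem IsOmegaGSBasis.agree_intersection (hG : IsOmegaGSBasis lt G)
    {s₁ s₂ : MonoidAlgebra k (OpWord Ω Z)} (hs₁ : s₁ ∈ G) (hs₂ : s₂ ∈ G) {b₁ b₂ : OpWord Ω Z}
    (hb₁ : IsLeadingMonomial lt s₁ b₁) (hb₂ : IsLeadingMonomial lt s₂ b₂) {u v : OpWord Ω Z}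
    (h : b₁ * u = v * b₂) (h₁ : max b₁.breadth b₂.breadth < (b₁ * u).breadth)
    (h₂ : (b₁ * u).breadth < b₁.breadth + b₂.breadth) :
    Agree lt G s₁ s₂ b₁ b₂ (· * u) (v * ·) := by
  have := (hG s₁ hs₁ s₂ hs₂ b₁ b₂ hb₁ hb₂ _ _ rfl rfl).1 (b₁ * u) u v rfl h h₁ h₂
  rwa [isTrivialMod_iff, mul_single_one, single_one_mul] at this

end MonomialOrders

namespace OpWord

/-! ### Relative positions of two occurrences in a word. -/

section Slots

variable {k Ω Z : Type*} [Field k] {lt : OpWord Ω Z → OpWord Ω Z → Prop}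
  {G : Set (MonoidAlgebra k (OpWord Ω Z))}

/-- The maps `u ↦ u` and `u ↦ ⌊c u⌋_ω`, as lists of letters. -/
def IsSlot (d : OpWord Ω Z → List (Z ⊕ Ω × OpWord Ω Z)) : Prop :=
  d = toList ∨ ∃ ω c, IsContext c ∧ d = fun u => [Sum.inr (ω, c u)]

theorem IsSlot.isContext {d : OpWord Ω Z → List (Z ⊕ Ω × OpWord Ω Z)} (hd : IsSlot d)
    {c : OpWord Ω Z → OpWord Ω Z} (A B : List (Z ⊕ Ω × OpWord Ω Z))
    (h : ∀ u, toList (c u) = A ++ d u ++ B) : IsContext c := by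
  rcases hd with rfl | ⟨ω, c', hc', rfl⟩
  · exact .base c A B h
  · exact .nest c c' A B ω hc' h

theorem IsSlot.ne_nil {d : OpWord Ω Z → List (Z ⊕ Ω × OpWord Ω Z)} (hd : IsSlot d)
    (u : OpWord Ω Z) : d u ≠ [] := by
  rcases hd with rfl | ⟨ω, c', hc', rfl⟩ <;> simp

/-- Filling both holes independently gives a two-variable context, to which the bilinear expansion
applies. No composition is involved. -/
theorem agree_of_disjoint (hlt : IsMonomialOrder lt) {s₁ s₂ : MonoidAlgebra k (OpWord Ω Z)}
    (hs₁ : s₁ ∈ G) (hs₂ : s₂ ∈ G) {b₁ b₂ : OpWord Ω Z} (hb₁ : IsLeadingMonomial lt s₁ b₁)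
    (hb₂ : IsLeadingMonomial lt s₂ b₂) {d₁ d₂ : OpWord Ω Z → List (Z ⊕ Ω × OpWord Ω Z)}
    (hd₁ : IsSlot d₁) (hd₂ : IsSlot d₂) {c₁ c₂ : OpWord Ω Z → OpWord Ω Z}
    {A E B : List (Z ⊕ Ω × OpWord Ω Z)}
    (hc₁ : ∀ u, toList (c₁ u) = A ++ d₁ u ++ E ++ d₂ b₂ ++ B)
    (hc₂ : ∀ u, toList (c₂ u) = A ++ d₁ b₁ ++ E ++ d₂ u ++ B) :
    Agree lt G s₁ s₂ b₁ b₂ c₁ c₂ := by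
  have hex : ∀ x y, ∃ w, toList w = A ++ d₁ x ++ E ++ d₂ y ++ B := fun x y =>
    exists_toList_eq (by simp [hd₁.ne_nil])
  choose F hF using hex
  have h := bilinMap_mem_levelSpan_of_disjoint (F := F)
    (fun y => mem_opContexts.2 (hd₁.isContext A (E ++ d₂ y ++ B) (by simp [hF])))
    (fun x => mem_opContexts.2 (hd₂.isContext (A ++ d₁ x ++ E) B (by simp [hF])))
    hlt.lt_of_mem_opContexts hs₁ hs₂ hb₁ hb₂
  obtain rfl : c₁ = (F · b₂) := funext fun u => by rw [← toList_inj, hc₁, hF]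
  obtain rfl : c₂ = F b₁ := funext fun u => by rw [← toList_inj, hc₂, hF]
  exact h

/-- Here `D` is the stretch from the start of `b₁` to the start of `b₂`. The occurrences are
disjoint, nested or properly overlapping, and the last two cases are an inclusion and an
intersection composition. -/
theorem agree_base_base (hlt : IsMonomialOrder lt) (hG : IsOmegaGSBasis lt G)
    {s₁ s₂ : MonoidAlgebra k (OpWord Ω Z)}
    (hs₁ : s₁ ∈ G) (hs₂ : s₂ ∈ G) {b₁ b₂ : OpWord Ω Z} (hb₁ : IsLeadingMonomial lt s₁ b₁)
    (hb₂ : IsLeadingMonomial lt s₂ b₂) {c₁ c₂ : OpWord Ω Z → OpWord Ω Z}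
    {A D B₁ B₂ : List (Z ⊕ Ω × OpWord Ω Z)} (hc₁ : ∀ u, toList (c₁ u) = A ++ toList u ++ B₁)
    (hc₂ : ∀ u, toList (c₂ u) = A ++ D ++ toList u ++ B₂) (h : c₁ b₁ = c₂ b₂) :
    Agree lt G s₁ s₂ b₁ b₂ c₁ c₂ := by
  have hdisj : ∀ E, D = toList b₁ ++ E → B₁ = E ++ toList b₂ ++ B₂ →
      Agree lt G s₁ s₂ b₁ b₂ c₁ c₂ := fun E h1 h2 =>
    agree_of_disjoint hlt hs₁ hs₂ hb₁ hb₂ (.inl rfl) (.inl rfl) (A := A) (E := E) (B := B₂)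
      (by simp [hc₁, h2]) (by simp [hc₂, h1])
  have hincl : ∀ K, toList b₁ = D ++ toList b₂ ++ K → B₂ = K ++ B₁ →
      Agree lt G s₁ s₂ b₁ b₂ c₁ c₂ := by
    intro K h1 h2
    have := (hG.agree_inclusion hs₁ hs₂ hb₁ hb₂ (q := fun u => wrap D u K)
      (isContext_id.wrap D K) (by simp [← toList_inj, h1])).comp hlt (.base c₁ A B₁ hc₁)
    convert this using 1
    · rfl
    funext u
    simp [← toList_inj, hc₁, hc₂, h2]
  have h' := congrArg toList h
  rw [hc₁, hc₂] at h'
  simp only [List.append_assoc, List.append_cancel_left_eq] at h'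
  rcases List.append_eq_append_iff.1 h' with ⟨E, h1, h2⟩ | ⟨F, h1, h2⟩
  · exact hdisj E h1 (by simpa using h2)
  rcases List.append_eq_append_iff.1 h2 with ⟨K, h3, h4⟩ | ⟨H, h3, h4⟩
  · exact hincl K (by simp [h1, h3]) h4
  by_cases hF : F = []
  · subst hF
    exact hdisj [] (by simpa using h1.symm) (by simp [h4, h3])
  by_cases hH : H = []
  · subst hH
    exact hincl [] (by simpa [h3] using h1) (by simpa using h4.symm)
  -- For empty `D` the word `b₁` is a prefix of `b₂`, an inclusion in the opposite direction.
  -- Otherwise both ends stick out, so the strict breadth bounds of an intersection hold.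
  by_cases hD : D = []
  · subst hD
    have := (hG.agree_inclusion hs₂ hs₁ hb₂ hb₁ (q := fun u => wrap [] u H)
      (isContext_id.wrap [] H) (by simp [← toList_inj, h1, h3])).comp hlt
        (.base c₂ A B₂ (by simpa using hc₂))
    refine Agree.symm ?_ h.symm
    convert this using 1
    · rfl
    funext u
    simp [← toList_inj, hc₁, hc₂, h4]
  obtain ⟨u, rfl⟩ := exists_toList_eq hH
  obtain ⟨v, rfl⟩ := exists_toList_eq hD
  have hFl := List.length_pos_iff.2 hF
  have hHl := List.length_pos_iff.2 hH
  have hDl := List.length_pos_iff.2 hD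
  have := (hG.agree_intersection hs₁ hs₂ hb₁ hb₂ (u := u) (v := v)
    (by simp [← toList_inj, h1, h3]) (by simp [breadth_eq_length, h1, h3]; omega)
    (by simp [breadth_eq_length, h1, h3]; omega)).comp hlt (isContext_id.wrap A B₂)
  convert this using 1
  · funext x
    simp [← toList_inj, hc₁, h4]
  · funext x
    simp [← toList_inj, hc₂]

/-- The bracket that encloses `b₂` cannot be a letter of the pure word `b₁`, so the two occurrences
are disjoint. -/
theorem agree_base_nest (hlt : IsMonomialOrder lt) {s₁ s₂ : MonoidAlgebra k (OpWord Ω Z)}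
    (hs₁ : s₁ ∈ G) (hs₂ : s₂ ∈ G) {b₁ b₂ : OpWord Ω Z} (hb₁ : IsLeadingMonomial lt s₁ b₁)
    (hb₂ : IsLeadingMonomial lt s₂ b₂) (hp : IsPure b₁) {c₁ c₂ c' : OpWord Ω Z → OpWord Ω Z}
    {A₁ A₂ B₁ B₂ : List (Z ⊕ Ω × OpWord Ω Z)} {ω : Ω} (hc' : IsContext c')
    (hc₁ : ∀ u, toList (c₁ u) = A₁ ++ toList u ++ B₁)
    (hc₂ : ∀ u, toList (c₂ u) = A₂ ++ [Sum.inr (ω, c' u)] ++ B₂) (h : c₁ b₁ = c₂ b₂) :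
    Agree lt G s₁ s₂ b₁ b₂ c₁ c₂ := by
  have h' := congrArg toList h
  rw [hc₁, hc₂] at h'
  have hsplit : ∀ l : Z ⊕ Ω × OpWord Ω Z, ∀ U V : List (Z ⊕ Ω × OpWord Ω Z), ∀ K₁ K₂, K₁ ≠ [] →
      K₂ ≠ [] → [l] = K₁ ++ K₂ → K₁ <:+ U → K₂ <+: V → False := by
    intro l U V K₁ K₂ h1 h2 h3 _ _
    have := congrArg List.length h3
    have h1 := List.length_pos_iff.2 h1
    have h2 := List.length_pos_iff.2 h2
    simp at this
    omega
  have hslot : IsSlot fun u => [Sum.inr (ω, c' u)] := .inr ⟨ω, c', hc', rfl⟩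
  rcases List.split_of_append_eq_append h'.symm (hsplit _ _ _) with ⟨B', h1, h2⟩ | ⟨A', h1, h2⟩
  · rcases List.split_of_append_eq_append h1.symm (hsplit _ _ _) with ⟨E, h3, h4⟩ | ⟨A', h3, -⟩
    · refine (agree_of_disjoint hlt hs₂ hs₁ hb₂ hb₁ hslot (.inl rfl) (A := A₂) (E := E)
        (B := B₁) ?_ ?_).symm h.symm
      · simp [hc₂, h2, h4]
      · simp [hc₁, h3]
    · have := hp (Sum.inr (ω, c' b₂)) (by simp [h3])
      simp at this
  · refine agree_of_disjoint hlt hs₁ hs₂ hb₁ hb₂ (.inl rfl) hslot (A := A₁) (E := A')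
      (B := B₂) ?_ ?_
    · simp [hc₁, h1]
    · simp [hc₂, h2]

/-- Two occurrences inside the same bracket are handled by induction on the depth, those in
different brackets are disjoint, and purity settles the case where just one is bracketed. -/
theorem isResolved_of_isPure (hlt : IsMonomialOrder lt) (hG : IsOmegaGSBasis lt G)
    (hpure : ∀ s ∈ G, ∀ b, IsLeadingMonomial lt s b → IsPure b) :
    IsResolved (opContexts Ω Z) lt G := by
  intro c₁ hc₁ c₂ hc₂ s₁ hs₁ s₂ hs₂ b₁ b₂ hb₁ hb₂ h
  rw [mem_opContexts] at hc₁ hc₂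
  change Agree lt G s₁ s₂ b₁ b₂ c₁ c₂
  induction hc₁ generalizing c₂ with
  | base c₁ A₁ B₁ h₁ =>
    cases hc₂ with
    | base _ A₂ B₂ h₂ =>
      have h' := congrArg toList h
      rw [h₁, h₂, List.append_assoc, List.append_assoc] at h'
      rcases List.append_eq_append_iff.1 h' with ⟨D, h3, -⟩ | ⟨D, h3, -⟩
      · exact agree_base_base hlt hG hs₁ hs₂ hb₁ hb₂ h₁ (fun u => by rw [h₂, h3]) h
      · exact (agree_base_base hlt hG hs₂ hs₁ hb₂ hb₁ h₂ (fun u => by rw [h₁, h3]) h.symm).symm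
          h.symm
    | nest _ c' A₂ B₂ ω hc' h₂ =>
      exact agree_base_nest hlt hs₁ hs₂ hb₁ hb₂ (hpure s₁ hs₁ b₁ hb₁) hc' h₁ h₂ h
  | nest c₁ c₁' A₁ B₁ ω₁ hc₁' h₁ ih =>
    cases hc₂ with
    | base _ A₂ B₂ h₂ =>
      exact (agree_base_nest hlt hs₂ hs₁ hb₂ hb₁ (hpure s₂ hs₂ b₂ hb₂) hc₁' h₂ h₁ h.symm).symm
        h.symm
    | nest _ c₂' A₂ B₂ ω₂ hc₂' h₂ =>
      have hslot₁ : IsSlot fun u => [Sum.inr (ω₁, c₁' u)] := .inr ⟨ω₁, c₁', hc₁', rfl⟩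
      have hslot₂ : IsSlot fun u => [Sum.inr (ω₂, c₂' u)] := .inr ⟨ω₂, c₂', hc₂', rfl⟩
      have h' := congrArg toList h
      rw [h₁, h₂, List.append_assoc, List.append_assoc] at h'
      rcases List.append_eq_append_iff.1 h' with ⟨D, h3, h4⟩ | ⟨D, h3, h4⟩
      · cases D with
        | nil =>
          simp only [List.nil_append, List.singleton_append, List.cons.injEq, Sum.inr.injEq,
            Prod.mk.injEq] at h4
          obtain ⟨⟨rfl, h4⟩, rfl⟩ := h4
          have := (ih c₂' hc₂' h4).comp hlt
            (((isContext_id (Ω := Ω) (Z := Z)).op ω₁).wrap A₁ B₁)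
          convert this using 1
          · funext u
            simp [← toList_inj, h₁]
          · funext u
            simp [← toList_inj, h₂, h3]
        | cons l E =>
          simp only [List.cons_append, List.cons.injEq] at h4
          refine agree_of_disjoint hlt hs₁ hs₂ hb₁ hb₂ hslot₁ hslot₂ (A := A₁) (E := E)
            (B := B₂) ?_ ?_
          · simp [h₁, h4.2]
          · simp [h₂, h3, h4.1]
      · cases D with
        | nil =>
          simp only [List.nil_append, List.singleton_append, List.cons.injEq, Sum.inr.injEq,
            Prod.mk.injEq] at h4
          obtain ⟨⟨rfl, h4⟩, rfl⟩ := h4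
          have := (ih c₂' hc₂' h4.symm).comp hlt
            (((isContext_id (Ω := Ω) (Z := Z)).op ω₂).wrap A₁ B₂)
          convert this using 1
          · funext u
            simp [← toList_inj, h₁]
          · funext u
            simp [← toList_inj, h₂, h3]
        | cons l E =>
          simp only [List.cons_append, List.cons.injEq] at h4
          refine (agree_of_disjoint hlt hs₂ hs₁ hb₂ hb₁ hslot₂ hslot₁ (A := A₂) (E := E)
            (B := B₁) ?_ ?_).symm h.symm
          · simp [h₂, h4.2]
          · simp [h₁, h3, h4.1]

end Slots

end OpWord

/-! ### From GS bases in k𝒮(Z) to Ω-GS bases in k𝔖(Z). -/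

section Image

variable {k Ω Z : Type*} [Field k] {lt : OpWord Ω Z → OpWord Ω Z → Prop}

theorem isOmegaGSBasis_of_agree {G : Set (MonoidAlgebra k (OpWord Ω Z))}
    (h₁ : ∀ f ∈ G, ∀ g ∈ G, ∀ a b, IsLeadingMonomial lt f a → IsLeadingMonomial lt g b →
      ∀ u v, a * u = v * b → max a.breadth b.breadth < (a * u).breadth →
        (a * u).breadth < a.breadth + b.breadth →
        Agree lt G f g a b (· * u) (v * ·))
    (h₂ : ∀ f ∈ G, ∀ g ∈ G, ∀ a b, IsLeadingMonomial lt f a → IsLeadingMonomial lt g b →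
      ∀ q, OpWord.IsContext q → a = q b → Agree lt G f g a b id q) : IsOmegaGSBasis lt G := by
  rintro f hf g hg a b ha hb _ _ rfl rfl
  refine ⟨?_, ?_⟩
  · rintro p u v rfl h h' h''
    rw [isTrivialMod_iff, mul_single_one, single_one_mul]
    exact h₁ f hf g hg a b ha hb u v h h' h''
  · rintro q hq p rfl h
    have := h₂ f hf g hg p b ha hb q (OpWord.mem_opContexts.1 hq) h
    rw [isTrivialMod_iff]
    rwa [Agree, mapDomain_id_apply] at this

theorem Agree.mono {G G' : Set (MonoidAlgebra k (OpWord Ω Z))} (hG : G ⊆ G')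
    {s₁ s₂ : MonoidAlgebra k (OpWord Ω Z)} {b₁ b₂ : OpWord Ω Z}
    {c₁ c₂ : OpWord Ω Z → OpWord Ω Z} (h : Agree lt G s₁ s₂ b₁ b₂ c₁ c₂) :
    Agree lt G' s₁ s₂ b₁ b₂ c₁ c₂ :=
  levelSpan_mono hG (fun _ h => h) h

namespace OpWord

/-- The bound on the breadth says that `a` and `b` together are too long to be disjoint. -/
theorem exists_overlap {a b u v : OpWord Ω Z} (h : a * u = v * b)
    (hlt : (a * u).breadth < a.breadth + b.breadth) :
    ∃ F, F ≠ [] ∧ toList a = toList v ++ F ∧ toList b = F ++ toList u := by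
  have h' := congrArg toList h
  simp only [breadth_eq_length, toList_mul, List.length_append] at h' hlt
  rcases List.append_eq_append_iff.1 h' with ⟨E, h1, h2⟩ | ⟨F, h1, h2⟩
  · have := congrArg List.length h2
    simp only [List.length_append] at this
    omega
  · refine ⟨F, ?_, h1, h2⟩
    rintro rfl
    rw [h2] at hlt
    simp at hlt

theorem IsContext.isPure {c : OpWord Ω Z → OpWord Ω Z} (hc : IsContext c) {w : OpWord Ω Z}
    (h : IsPure (c w)) : IsPure w := by
  cases hc with
  | base _ A B hc => exact fun l hl => h l (by simp [hc, hl])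
  | nest _ c' A B ω hc' hc =>
    have := h (Sum.inr (ω, c' w)) (by simp [hc])
    simp at this

theorem exists_isContext_of_mem_wordContexts {q : FreeSemigroup Z → FreeSemigroup Z}
    (hq : q ∈ wordContexts Z) :
    ∃ c : OpWord Ω Z → OpWord Ω Z, IsContext c ∧ ∀ u, c (ofWord u) = ofWord (q u) := by
  obtain ⟨a, b, h⟩ := hq
  induction a using WithOne.recOneCoe with
  | one =>
    induction b using WithOne.recOneCoe with
    | one =>
      refine ⟨id, isContext_id, fun u => congrArg ofWord ?_⟩
      simpa using (h u).symm
    | coe b =>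
      refine ⟨fun u => u * ofWord b, isContext_id.mul_right _, fun u => ?_⟩
      have : q u = u * b := by simpa [← WithOne.coe_mul] using h u
      rw [this, ofWord_mul]
  | coe a =>
    induction b using WithOne.recOneCoe with
    | one =>
      refine ⟨fun u => ofWord a * u, isContext_id.mul_left _, fun u => ?_⟩
      have : q u = a * u := by simpa [← WithOne.coe_mul] using h u
      rw [this, ofWord_mul]
    | coe b =>
      refine ⟨fun u => ofWord a * u * ofWord b, (isContext_id.mul_left _).mul_right _,
        fun u => ?_⟩
      have : q u = a * u * b := by simpa [← WithOne.coe_mul] using h u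
      rw [this, ofWord_mul, ofWord_mul]

theorem IsContext.exists_mem_wordContexts {c : OpWord Ω Z → OpWord Ω Z} (hc : IsContext c)
    {w : OpWord Ω Z} (h : IsPure (c w)) :
    ∃ q ∈ wordContexts Z, ∀ u, c (ofWord u) = ofWord (q u) := by
  have hone : ∀ L : List (Z ⊕ Ω × OpWord Ω Z), (∀ l ∈ L, l.isLeft) →
      L = [] ∨ ∃ v, L = toList (ofWord v) := by
    intro L hL
    refine or_iff_not_imp_left.2 fun hne => ?_
    obtain ⟨w, rfl⟩ := exists_toList_eq hne
    obtain ⟨v, rfl⟩ := IsPure.exists_ofWord hL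
    exact ⟨v, rfl⟩
  cases hc with
  | base _ A B hc =>
    rcases hone A (fun l hl => h l (by simp [hc, hl])) with rfl | ⟨a, rfl⟩ <;>
    rcases hone B (fun l hl => h l (by simp [hc, hl])) with rfl | ⟨b, rfl⟩
    · exact ⟨id, ⟨1, 1, by simp⟩, fun u => by simp [← toList_inj, hc]⟩
    · exact ⟨fun u => u * b, ⟨1, b, by simp⟩, fun u => by simp [← toList_inj, hc, ofWord_mul]⟩
    · exact ⟨fun u => a * u, ⟨a, 1, by simp⟩, fun u => by simp [← toList_inj, hc, ofWord_mul]⟩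
    · exact ⟨fun u => a * u * b, ⟨a, b, by simp⟩,
        fun u => by simp [← toList_inj, hc, ofWord_mul]⟩
  | nest _ c' A B ω hc' hc =>
    have := h (Sum.inr (ω, c' w)) (by simp [hc])
    simp at this

end OpWord

open OpWord

theorem isLeadingMonomial_ofWord_iff {s : MonoidAlgebra k (FreeSemigroup Z)}
    {a : FreeSemigroup Z} : IsLeadingMonomial lt (mapDomain ofWord s) (ofWord a) ↔
      IsLeadingMonomial (fun u v => lt (ofWord u) (ofWord v)) s a :=
  IsLeadingMonomial.mapDomain_of_injective ofWord_injective fun _ _ => Iff.rfl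

theorem IsLeadingMonomial.exists_ofWord {s : MonoidAlgebra k (FreeSemigroup Z)} {a : OpWord Ω Z}
    (h : IsLeadingMonomial lt (mapDomain ofWord s) a) : ∃ a', ofWord a' = a := by
  classical
  obtain ⟨a', -, h'⟩ := Finset.mem_image.1 (Finsupp.mapDomain_support h.1)
  exact ⟨a', h'⟩

theorem mapDomain_ofWord_mem_levelSpan {G : Set (MonoidAlgebra k (FreeSemigroup Z))}
    {p : FreeSemigroup Z} {f : MonoidAlgebra k (FreeSemigroup Z)}
    (hf : IsTrivialMod (wordContexts Z) (fun u v => lt (ofWord u) (ofWord v)) G p f) :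
    mapDomain ofWord f ∈ levelSpan (opContexts Ω Z) lt (mapDomain ofWord '' G)
      (lt · (ofWord p)) := by
  refine mapDomain_mem_levelSpan_of (fun q hq s hs m hm hp => ?_) (isTrivialMod_iff.1 hf)
  obtain ⟨c, hc, hcq⟩ := exists_isContext_of_mem_wordContexts (Ω := Ω) hq
  refine Submodule.subset_span ⟨c, mem_opContexts.2 hc, _, ⟨s, hs, rfl⟩, ofWord m,
    isLeadingMonomial_ofWord_iff.2 hm, ?_, ?_⟩
  · rw [hcq]
    exact hp
  · rw [mapDomain_comp_apply, mapDomain_comp_apply]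
    congr 1
    funext u
    exact (hcq u).symm

/-- The factors `u`, `v` of an intersection and the context of an inclusion are parts of pure words,
so every composition already comes from the free semigroup; its trivial expression is then
transported. -/
theorem isOmegaGSBasis_image_ofWord {G : Set (MonoidAlgebra k (FreeSemigroup Z))}
    (hG : IsGSBasis (wordContexts Z) FreeSemigroup.length
      (fun u v => lt (ofWord u) (ofWord v)) G) :
    IsOmegaGSBasis lt (mapDomain (ofWord (Ω := Ω)) '' G) := by
  have hcoeff : ∀ (s : MonoidAlgebra k (FreeSemigroup Z)) (a : FreeSemigroup Z),
      ((mapDomain (ofWord (Ω := Ω)) s).coeff (ofWord a))⁻¹ • mapDomain (ofWord (Ω := Ω)) s =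
        mapDomain ofWord ((s.coeff a)⁻¹ • s) := fun s a => by
    rw [mapDomain_smul, coeff_mapDomain, Finsupp.mapDomain_apply ofWord_injective]
  rintro _ ⟨s₁, hs₁, rfl⟩ _ ⟨s₂, hs₂, rfl⟩ a b ha hb _ _ rfl rfl
  obtain ⟨a, rfl⟩ := ha.exists_ofWord
  obtain ⟨b, rfl⟩ := hb.exists_ofWord
  rw [isLeadingMonomial_ofWord_iff] at ha hb
  have h := hG s₁ hs₁ s₂ hs₂ a b ha hb _ _ rfl rfl
  rw [hcoeff, hcoeff]
  refine ⟨?_, ?_⟩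
  · rintro p u v rfl hp h1 h2
    obtain ⟨F, -, hF1, hF2⟩ := exists_overlap hp h2
    obtain ⟨u, rfl⟩ := IsPure.exists_ofWord (w := u)
      fun l hl => isPure_ofWord b l (by simp [hF2, hl])
    obtain ⟨v, rfl⟩ := IsPure.exists_ofWord (w := v)
      fun l hl => isPure_ofWord a l (by simp [hF1, hl])
    rw [← ofWord_mul, ← ofWord_mul] at hp
    rw [← ofWord_mul] at h1 h2
    simp only [breadth_ofWord] at h1 h2
    have := mapDomain_ofWord_mem_levelSpan (h.1 (a * u) u v rfl (ofWord_injective hp) h1 h2)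
    rw [isTrivialMod_iff, mul_single_one, single_one_mul, mapDomain_comp_apply,
      mapDomain_comp_apply, ← ofWord_mul]
    rw [mul_single_one, single_one_mul, mapDomain_sub, mapDomain_comp_apply,
      mapDomain_comp_apply] at this
    convert this using 3
    · funext x
      exact (ofWord_mul x u).symm
    · funext x
      exact (ofWord_mul v x).symm
  · rintro c hc p rfl hp
    obtain ⟨q, hq, hcq⟩ := (mem_opContexts.1 hc).exists_mem_wordContexts (w := ofWord b)
      (hp ▸ isPure_ofWord a)
    have := mapDomain_ofWord_mem_levelSpan (h.2 q hq a rfl (ofWord_injective (by rw [hp, hcq])))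
    rw [isTrivialMod_iff, mapDomain_comp_apply]
    rw [mapDomain_sub, mapDomain_comp_apply] at this
    convert this using 3
    funext x
    exact hcq x

end Image

/-! ### Generated ideals. -/

section Ideals

variable {k Ω Z : Type*} [Field k]

theorem subset_algIdealSpan {S : Type*} [Semigroup S] (T : Set (MonoidAlgebra k S)) :
    T ⊆ algIdealSpan T := fun x hx => by
  simp only [algIdealSpan, SetLike.mem_coe, Submodule.mem_sInf, Set.mem_ofPred_eq]
  exact fun I hI => hI.2 hx

theorem algIdealSpan_le {S : Type*} [Semigroup S] {T : Set (MonoidAlgebra k S)}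
    {I : Submodule k (MonoidAlgebra k S)} (hI : IsAlgIdeal I) (hT : T ⊆ I) : algIdealSpan T ≤ I :=
  sInf_le ⟨hI, hT⟩

theorem omegaIdealSpan_mono {T T' : Set (MonoidAlgebra k (OpWord Ω Z))} (h : T ⊆ T') :
    omegaIdealSpan T ≤ omegaIdealSpan T' :=
  sInf_le_sInf fun _ hI => ⟨hI.1, h.trans hI.2⟩

theorem IsAlgIdeal.comap_ofWord {I : Submodule k (MonoidAlgebra k (OpWord Ω Z))}
    (hI : IsAlgIdeal I) : IsAlgIdeal (I.comap (mapDomainLinearMap k k OpWord.ofWord)) := by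
  intro x hx a
  have h : ∀ y z : MonoidAlgebra k (FreeSemigroup Z), mapDomain (OpWord.ofWord (Ω := Ω)) (y * z) =
      mapDomain OpWord.ofWord y * mapDomain OpWord.ofWord z := fun y z =>
    mapDomain_mul (FreeSemigroup.lift OpWord.var) y z
  have := hI _ hx (mapDomain OpWord.ofWord a)
  exact ⟨show mapDomain OpWord.ofWord (a * x) ∈ I by rw [h]; exact this.1,
    show mapDomain OpWord.ofWord (x * a) ∈ I by rw [h]; exact this.2⟩

/-- An Ω-ideal pulls back to an ideal of k𝒮(Z), so once it contains `G` it contains the ideal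
generated by `G`. -/
theorem omegaIdealSpan_union_algIdealSpan (S : Set (MonoidAlgebra k (OpWord Ω Z)))
    (G : Set (MonoidAlgebra k (FreeSemigroup Z))) :
    omegaIdealSpan (S ∪ mapDomain OpWord.ofWord '' G) =
      omegaIdealSpan (S ∪ mapDomain OpWord.ofWord ''
        (algIdealSpan G : Set (MonoidAlgebra k (FreeSemigroup Z)))) := by
  refine le_antisymm (omegaIdealSpan_mono (Set.union_subset_union_right _
    (Set.image_mono (subset_algIdealSpan G)))) (sInf_le_sInf ?_)
  rintro I ⟨hI, hT⟩
  refine ⟨hI, Set.union_subset (Set.subset_union_left.trans hT) ?_⟩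
  rintro _ ⟨x, hx, rfl⟩
  exact algIdealSpan_le hI.1.comap_ofWord (fun y hy => hT (.inr ⟨y, hy, rfl⟩)) hx

end Ideals

open OpWord

/-! ### Mixed compositions of OPIs with elements of `G`. -/

section OPIs

variable {k Ω X Z : Type*} [Field k] {lt : OpWord Ω Z → OpWord Ω Z → Prop}

theorem coeff_mapDomain_of_forall_ne {S T : Type*} {f : S → T} {φ : MonoidAlgebra k S} {m : S}
    (h : ∀ m' ∈ φ.coeff.support, m' ≠ m → f m' ≠ f m) :
    (mapDomain f φ).coeff (f m) = φ.coeff m := by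
  rw [coeff_mapDomain, Finsupp.mapDomain, Finsupp.sum_apply, Finsupp.sum,
    Finset.sum_eq_single m]
  · simp
  · intro m' hm' hne
    simp [h m' hm' hne]
  · intro hm
    simpa using hm

/-- The monomials of an OPI other than its leading one never become equal to it. -/
theorem IsOPI.subst_ne_subst {φ : MonoidAlgebra k (OpWord Ω X)} (hφ : IsOPI φ)
    (hwf : WellFounded lt) {m : OpWord Ω X} (hm : m ∈ φ.coeff.support) (hadj : NoAdj m)
    (hlead : ∀ σ, opiEval φ σ = 0 ∨ IsLeadingMonomial lt (opiEval φ σ) (subst σ m))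
    {m' : OpWord Ω X} (hm' : m' ∈ φ.coeff.support) (hne : m' ≠ m) (σ : X → OpWord Ω Z) :
    subst σ m' ≠ subst σ m := by
  obtain ⟨V, -, hV⟩ := hφ
  rcases isEmpty_or_nonempty Ω with hΩ | hΩ
  -- Codes need a bracket. Without operators `m` is a single variable, and so is every other
  -- monomial of `φ`.
  · obtain ⟨x, rfl⟩ := eq_var_of_isEmpty hadj
    have h : (m'.letters : Multiset X) = {x} := (hV m' hm').trans (hV _ hm).symm
    exact (hne (eq_var_of_letters_eq (Multiset.coe_eq_singleton.1 h))).elim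
  · refine OpWord.subst_ne_subst hwf (S := (φ.coeff.support : Set (OpWord Ω X))) hV hm hm'
      (fun τ hτ => ?_) σ
    -- Where `τ` is injective on the support nothing cancels, so the leading monomial m(τ) must
    -- exceed every other m'(τ).
    have hcoeff : ∀ m₁ ∈ φ.coeff.support, (opiEval φ τ).coeff (subst τ m₁) ≠ 0 := by
      intro m₁ h₁
      rw [opiEval, coeff_mapDomain_of_forall_ne fun m₂ h₂ hne h => hne (hτ h₂ h₁ h)]
      exact Finsupp.mem_support_iff.1 h₁
    rcases hlead τ with h | h
    · exact (hcoeff m hm (by simp [h])).elim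
    · exact h.2 _ (Finsupp.mem_support_iff.2 (hcoeff m' hm')) fun h => hne (hτ hm' hm h)

/-- No other monomial of `φ` collides with `m` under `σ`, so the nonzero coefficient of `m` survives
and φ(σ) cannot vanish. -/
theorem IsOPI.isLeadingMonomial_opiEval {φ : MonoidAlgebra k (OpWord Ω X)} (hφ : IsOPI φ)
    (hwf : WellFounded lt) {m : OpWord Ω X} (hm : m ∈ φ.coeff.support) (hadj : NoAdj m)
    (hlead : ∀ σ, opiEval φ σ = 0 ∨ IsLeadingMonomial lt (opiEval φ σ) (subst σ m))
    (σ : X → OpWord Ω Z) : IsLeadingMonomial lt (opiEval φ σ) (subst σ m) := by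
  refine (hlead σ).resolve_left fun h => Finsupp.mem_support_iff.1 hm ?_
  rw [← coeff_mapDomain_of_forall_ne fun m' hm' hne =>
    hφ.subst_ne_subst hwf hm hadj hlead hm' hne σ, ← opiEval, h]
  simp

open Classical in
/-- The inclusion composition of `φ(σ)` and `g` is trivial if the leading monomial of `g` is
pure. -/
theorem IsOPI.agree_inclusion (hlt : IsMonomialOrder lt) {φ : MonoidAlgebra k (OpWord Ω X)}
    (hφ : IsOPI φ) {m : OpWord Ω X} (hm : m ∈ φ.coeff.support) (hadj : NoAdj m)
    (hlead : ∀ σ, IsLeadingMonomial lt (opiEval φ σ) (subst σ m))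
    {S G : Set (MonoidAlgebra k (OpWord Ω Z))} (hS : ∀ σ, opiEval φ σ ∈ S)
    (hG : IsResolved (opContexts Ω Z) lt G) {g : MonoidAlgebra k (OpWord Ω Z)} (hg : g ∈ G)
    {b : OpWord Ω Z} (hb : IsLeadingMonomial lt g b) (hpure : IsPure b) {σ : X → OpWord Ω Z}
    {c : OpWord Ω Z → OpWord Ω Z} (hc : IsContext c) (h : subst σ m = c b) :
    Agree lt (S ∪ G) (opiEval φ σ) g (subst σ m) b id c := by
  have := hlt.wellOrder
  obtain ⟨V, -, hV⟩ := hφ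
  have hnd : ∀ m' ∈ φ.coeff.support, m'.letters.Nodup := fun m' hm' => by
    rw [← Multiset.coe_nodup, hV m' hm']
    exact V.nodup
  obtain ⟨x, hx, r, hr, hσx, hy⟩ := exists_occurrence hadj (hnd m hm) hc hpure h.symm
  have hxmem : ∀ m' ∈ φ.coeff.support, x ∈ m'.letters := fun m' hm' => by
    rwa [← Multiset.mem_coe, hV m' hm', ← hV m hm]
  let F : OpWord Ω X → OpWord Ω Z → OpWord Ω Z := fun m' y => subst (Function.update σ x (r y)) m'
  have hFb : mapDomain (F · b) φ = opiEval φ σ := by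
    have : Function.update σ x (r b) = σ := by rw [← hσx, Function.update_eq_self]
    simp only [F, this]
    rfl
  set p := subst σ m
  set κ := (opiEval φ σ).coeff p
  have hĝ : IsMonicAt lt ((g.coeff b)⁻¹ • g) b := hb.isMonicAt
  set ĝ := (g.coeff b)⁻¹ • g with hĝ_def
  -- Expansion along `φ`: by multilinearity `x` occurs once in each monomial, so each summand is a
  -- context applied to `ĝ`. No bound on the levels is available.
  have hE : bilinMap F φ ĝ ∈ levelSpan (opContexts Ω Z) lt G fun _ => True :=
    bilinMap_mem _ fun m' hm' => smul_mapDomain_mem_levelSpan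
      (mem_opContexts.2 (isContext_subst_update (hnd m' hm') (hxmem m' hm') σ hr)) hg hb trivial _
  -- Expansion along `ĝ`: the monomials y < b contribute instances of `φ` with leading monomial c(y)
  -- < c(b) = p.
  have hR : bilinMap (fun y m' => F m' y) (ĝ - single b 1) φ ∈
      levelSpan (opContexts Ω Z) lt S (lt · p) := by
    refine bilinMap_mem _ fun y hy' => Submodule.subset_span ⟨id, mem_opContexts.2 isContext_id,
      opiEval φ (Function.update σ x (r y)), hS _, _, hlead _, ?_, (mapDomain_id_apply _).symm⟩
    rw [id, hy, h]
    exact hlt.lt_of_mem_opContexts c (mem_opContexts.2 hc) _ _ (hĝ hy')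
  set R := bilinMap (fun y m' => F m' y) (ĝ - single b 1) φ with hR_def
  have hER : bilinMap F φ ĝ = R + opiEval φ σ := by
    rw [hR_def, bilinMap_sub_left, bilinMap_single_left, hFb, bilinMap_comm F]
    abel
  have hcg : mapDomain c ĝ ∈ levelSpan (opContexts Ω Z) lt G fun _ => True :=
    smul_mapDomain_mem_levelSpan (mem_opContexts.2 hc) hg hb trivial _
  have hmono := hlt.lt_of_mem_opContexts
  have hcĝ : IsMonicAt lt (mapDomain c ĝ) p :=
    h ▸ hĝ.mapDomain fun u => hmono c (mem_opContexts.2 hc) u b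
  -- The leading terms cancel, so all monomials are below `p`; the Composition-Diamond lemma for `G`
  -- then supplies the missing bound on the levels.
  have hH : κ⁻¹ • bilinMap F φ ĝ - mapDomain c ĝ ∈ levelSpan (opContexts Ω Z) lt G (lt · p) := by
    refine hG.mem_levelSpan this.toIsWellFounded.wf hmono
      (Submodule.sub_mem _ (Submodule.smul_mem _ _ hE) hcg) ?_
    have h1 := (hlead σ).isMonicAt.sub_mem hcĝ
    have h2 := Submodule.smul_mem _ κ⁻¹ (levelSpan_le_lowerSub hmono p hR)
    convert Submodule.add_mem _ h1 h2 using 1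
    rw [hER, smul_add]
    abel
  rw [Agree, mapDomain_id_apply, id]
  have h1 := levelSpan_mono (G' := S ∪ G) Set.subset_union_right (fun _ h => h) hH
  have h2 := levelSpan_mono (G' := S ∪ G) Set.subset_union_left (fun _ h => h) hR
  convert Submodule.sub_mem _ h1 (Submodule.smul_mem _ κ⁻¹ h2) using 1
  rw [hER, smul_add]
  abel

/-- The composition of `φ(σ)` and `g` is trivial if it is given by an ambiguity `c₁|_{φ̄(σ)}` which
is itself of the form `φ̄(σ')`. -/
theorem IsOPI.agree (hlt : IsMonomialOrder lt) {φ : MonoidAlgebra k (OpWord Ω X)}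
    (hφ : IsOPI φ) {m : OpWord Ω X} (hm : m ∈ φ.coeff.support) (hadj : NoAdj m)
    (hlead : ∀ σ, IsLeadingMonomial lt (opiEval φ σ) (subst σ m))
    {S G : Set (MonoidAlgebra k (OpWord Ω Z))} (hS : ∀ σ, opiEval φ σ ∈ S)
    (hSGS : IsOmegaGSBasis lt S) (hG : IsResolved (opContexts Ω Z) lt G)
    {g : MonoidAlgebra k (OpWord Ω Z)} (hg : g ∈ G) {b : OpWord Ω Z}
    (hb : IsLeadingMonomial lt g b) (hpure : IsPure b) {σ σ' : X → OpWord Ω Z}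
    {c₁ c₂ : OpWord Ω Z → OpWord Ω Z} (hc₁ : IsContext c₁) (hc₂ : IsContext c₂)
    (h₁ : subst σ' m = c₁ (subst σ m)) (h₂ : subst σ' m = c₂ b) :
    Agree lt (S ∪ G) (opiEval φ σ) g (subst σ m) b c₁ c₂ := by
  -- Both sides are compared with φ(σ'): with c₂(g) by the mixed inclusion, with c₁(φ(σ)) by an
  -- inclusion composition within `S`. In general φ(σ') differs from c₁(φ(σ)), since only the
  -- leading monomials are known to match.
  have h := hφ.agree_inclusion hlt hm hadj hlead hS hG hg hb hpure hc₂ h₂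
  have h' := (hSGS.agree_inclusion (hS σ') (hS σ) (hlead σ') (hlead σ) hc₁ h₁).mono
    (G' := S ∪ G) Set.subset_union_left
  have := Submodule.sub_mem _ h h'
  rwa [sub_sub_sub_cancel_left, id, h₁] at this

end OPIs

theorem mainTheorem4 {k Ω X Z : Type*} [Field k]
    -- a system `Φ` of OPIs, and the linear order on `𝔖(X)` that defines their leading monomials
    (Φ : Set (MonoidAlgebra k (OpWord Ω X))) (hΦ : ∀ φ ∈ Φ, IsOPI φ)
    (ltX : OpWord Ω X → OpWord Ω X → Prop) (hltX : IsStrictTotalOrder (OpWord Ω X) ltX)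
    -- a monomial order on `𝔖(Z)` for which `Φ` is `Ω`-GS
    (lt : OpWord Ω Z → OpWord Ω Z → Prop) (hlt : IsMonomialOrder lt)
    (hΦGS : IsOmegaGS Φ lt)
    -- `A = k𝒮(Z) / I_A`, and a GS basis `G` of `I_A` for the restricted order
    (I_A : Submodule k (MonoidAlgebra k (FreeSemigroup Z))) (hI : IsAlgIdeal I_A)
    (G : Set (MonoidAlgebra k (FreeSemigroup Z)))
    (hG : IsGSBasisOf (fun u v => lt (OpWord.ofWord u) (OpWord.ofWord v)) G I_A)
    -- leading monomials of elements of `Φ` have no subword in `𝒮(X) \ X`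
    (hsub : ∀ φ ∈ Φ, ∀ m, IsLeadingMonomial ltX φ m →
      ∀ v : FreeSemigroup X, OpWord.IsSubword (OpWord.ofWord v) m → ∃ x, v = FreeSemigroup.of x)
    -- `φ(u_1, …, u_n)` vanishes or its leading monomial is `φ̄(u_1, …, u_n)`
    (hlead : ∀ φ ∈ Φ, ∀ m, IsLeadingMonomial ltX φ m → ∀ σ : X → OpWord Ω Z,
      opiEval φ σ = 0 ∨ IsLeadingMonomial lt (opiEval φ σ) (OpWord.subst σ m)) :
    IsOmegaGSBasisOf lt
      (opiInstances Φ Z ∪ MonoidAlgebra.mapDomain OpWord.ofWord '' G)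
      (omegaIdealSpan
        (opiInstances Φ Z ∪ MonoidAlgebra.mapDomain OpWord.ofWord ''
          (I_A : Set (MonoidAlgebra k (FreeSemigroup Z))))) := by
  classical
  have := hlt.wellOrder
  obtain ⟨hGGS, rfl⟩ := hG
  refine ⟨?_, omegaIdealSpan_union_algIdealSpan _ _⟩
  have hG' : IsOmegaGSBasis lt (mapDomain (ofWord (Ω := Ω)) '' G) :=
    isOmegaGSBasis_image_ofWord hGGS
  have hpure : ∀ s ∈ mapDomain (ofWord (Ω := Ω)) '' G, ∀ b, IsLeadingMonomial lt s b →
      IsPure b := by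
    rintro _ ⟨s, -, rfl⟩ b hb
    obtain ⟨b, rfl⟩ := hb.exists_ofWord
    exact isPure_ofWord b
  have hres := isResolved_of_isPure hlt hG' hpure
  have hopi : ∀ f ∈ opiInstances Φ Z, ∀ a, IsLeadingMonomial lt f a →
      ∃ (φ : MonoidAlgebra k (OpWord Ω X)) (m : OpWord Ω X) (σ : X → OpWord Ω Z),
        f = opiEval φ σ ∧ a = subst σ m ∧ m.letters.Nodup ∧ (IsPure m → ∃ x, m = var x) ∧
        ∀ g ∈ mapDomain (ofWord (Ω := Ω)) '' G, ∀ b, IsLeadingMonomial lt g b →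
          ∀ σ' c₁ c₂, IsContext c₁ → IsContext c₂ → subst σ' m = c₁ (subst σ m) →
            subst σ' m = c₂ b → Agree lt (opiInstances Φ Z ∪ mapDomain (ofWord (Ω := Ω)) '' G)
              (opiEval φ σ) g (subst σ m) b c₁ c₂ := by
    rintro _ ⟨φ, hφ, σ, rfl⟩ a ha
    obtain ⟨m, hm⟩ := exists_isLeadingMonomial (lt := ltX) (f := φ) (by
      rintro rfl
      exact ha.coeff_ne_zero (by simp [opiEval]))
    have hadj : NoAdj m := noAdj_of_subwords fun c hc v hv => by
      obtain ⟨q, hq, rfl⟩ := hc.exists_plug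
      exact hsub φ hφ m hm v ⟨q, hq, hv⟩
    have hlead' := (hΦ φ hφ).isLeadingMonomial_opiEval this.toIsWellFounded.wf hm.1 hadj
      (hlead φ hφ m hm)
    obtain ⟨V, -, hV⟩ := hΦ φ hφ
    refine ⟨φ, m, σ, rfl, ha.unique (hlead' σ), ?_, fun hp => ?_, ?_⟩
    · rw [← Multiset.coe_nodup, hV m hm.1]
      exact V.nodup
    · obtain ⟨v, rfl⟩ := hp.exists_ofWord
      obtain ⟨x, rfl⟩ := hsub φ hφ _ hm v ⟨var none, by rfl, rfl⟩
      exact ⟨x, rfl⟩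
    · intro g hg b hb σ' c₁ c₂ hc₁ hc₂ h₁ h₂
      exact (hΦ φ hφ).agree hlt hm.1 hadj hlead' (S := opiInstances Φ Z)
        (fun σ => ⟨φ, hφ, σ, rfl⟩) hΦGS hres hg hb
        (hpure g hg b hb) hc₁ hc₂ h₁ h₂
  refine isOmegaGSBasis_of_agree ?_ ?_
  · rintro f (hf | hf) g (hg | hg) a b ha hb u v h hmax h'
    · exact (IsOmegaGSBasis.agree_intersection hΦGS hf hg ha hb h hmax h').mono
        Set.subset_union_left
    · obtain ⟨φ, m, σ, rfl, rfl, hnd, -, hagree⟩ := hopi f hf a ha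
      -- A final bracket would lie in the overlap, hence in the pure word `b`. So `m` ends in a
      -- variable, and its value absorbs `u`.
      rcases endsOp_or_exists_update hnd σ with ⟨l, L, hL⟩ | ⟨x, -, hx⟩
      · obtain ⟨F, hF, h1, h2⟩ := exists_overlap h h'
        obtain ⟨F, l', rfl⟩ := (List.eq_nil_or_concat' F).resolve_left hF
        rw [hL, ← List.append_assoc] at h1
        obtain rfl : Sum.inr l = l' := by simpa using (List.append_inj' h1 rfl).2
        have := hpure g hg b hb (Sum.inr l) (by simp [h2])
        simp at this
      · exact hagree g hg b hb _ _ _ (isContext_id.mul_right u) (isContext_id.mul_left v)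
          (hx u) ((hx u).trans h)
    · obtain ⟨φ, m, σ, rfl, rfl, hnd, -, hagree⟩ := hopi g hg b hb
      rcases startsOp_or_exists_update hnd σ with ⟨l, L, hL⟩ | ⟨x, hx⟩
      · obtain ⟨F, hF, h1, h2⟩ := exists_overlap h h'
        obtain ⟨l', F, rfl⟩ := List.exists_cons_of_ne_nil hF
        rw [hL, List.cons_append, List.cons.injEq] at h2
        have := hpure f hf a ha (Sum.inr l) (by simp [h1, h2.1])
        simp at this
      · exact (hagree f hf a ha _ _ _ (isContext_id.mul_left v) (isContext_id.mul_right u)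
          (hx v) ((hx v).trans h.symm)).symm h.symm
    · exact (hG'.agree_intersection hf hg ha hb h hmax h').mono Set.subset_union_right
  · rintro f (hf | hf) g (hg | hg) a b ha hb q hq h
    · exact (IsOmegaGSBasis.agree_inclusion hΦGS hf hg ha hb hq h).mono Set.subset_union_left
    · obtain ⟨φ, m, σ, rfl, rfl, -, -, hagree⟩ := hopi f hf a ha
      exact hagree g hg b hb σ id q isContext_id hq rfl h
    · obtain ⟨φ, m, σ, rfl, rfl, -, hvar, hagree⟩ := hopi g hg b hb
      -- Being contained in the pure word `a`, the leading monomial of the OPI is a single variable;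
      -- substituting all of `a` for it makes `a` an instance.
      obtain ⟨x, rfl⟩ := hvar (isPure_of_subst (hq.isPure (h ▸ hpure f hf a ha)))
      exact (hagree f hf a ha (fun _ => a) q id hq isContext_id h rfl).symm h.symm
    · exact (hG'.agree_inclusion hf hg ha hb hq h).mono Set.subset_union_right
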